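/- **Setting.** Let $\mathcal X\subset\mathbb R^n$ and $\mathcal Y\subset\mathbb R^m$ be closed and convex, and let $\mathcal P(\cdot)$ denote the set of Borel probability measures. Let $(\Omega,\mathcal G,P)$ be a probability space with independent sub-$\sigma$-fields $\mathcal F,\tilde{\mathcal F}\subset\mathcal G$, where $\tilde{\mathcal F}$ carries a random variable uniformly distributed on $[0,1]$. Let $\mathcal A$ be a nonempty set of $\mathcal F$-measurable random variables $X:\Omega\to\mathcal X$, let $\mathcal A_\mu\subset\mathcal P(\mathcal X)$ be the set of their distributions, let $\nu_0\in\mathcal P(\mathcal Y)$ and $U:\mathcal X\times\mathcal Y\to\mathbb R$. Let $\varphi:[0,\infty)\to[0,\infty]$ be convex, lower semicontinuous and finite at some point of $(0,\infty)$; put $\varphi'_\infty=\lim_{s\to\infty}\varphi(s)/s$, and for $\nu\in\mathcal P(\mathcal Y)$ with Lebesgue decomposition $\nu=\sigma\nu_0+\nu^\perp$ put $D_\varphi(\nu,\nu_0)=\int\varphi(\sigma)\,d\nu_0+\varphi'_\infty\,\nu^\perp(\mathcal Y)$, with $0\cdot\infty=0$. For $\eta\in\mathbb R$ let $D_\eta=\{\nu\in\mathcal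 P(\mathcal Y):D_\varphi(\nu,\nu_0)\le\eta\}$. For $\mu\in\mathcal P(\mathcal X)$ let $\Gamma_\mu$ be the set of $\gamma\in\mathcal P(\mathcal X\times\mathcal Y)$ with first marginal $\mu$, and write $\pi_2^\sharp\gamma$ for the second marginal of $\gamma$. Consider the following problems, with values in $[-\infty,\infty]$: $$J^{p,d}(\theta)=\sup_{\mu\in\mathcal A_\mu}\inf_{\gamma\in\Gamma_\mu}\Big\{\int U\,d\gamma+\theta D_\varphi(\pi_2^\sharp\gamma,\nu_0)\Big\}\quad(\theta\ge0),$$ $$J^{c,d}(\eta)=\sup_{\mu\in\mathcal A_\mu}\ \inf_{\gamma\in\Gamma_\mu,\ \pi_2^\sharp\gamma\in D_\eta}\int U\,d\gamma,\qquad J^{c}(\eta)=\sup_{X\in\mathcal A}\ \inf_{Y\sim\nu\in D_\eta}\mathbb E[U(X,Y)],$$ where in $J^c$ the variable $Y$ ranges over all $\mathcal F\vee\tilde{\mathcal F}$-measurable maps $\Omega\to\mathcal Y$ whose distribution lies in $D_\eta$ (so $Y$ may depend on $X$). An optimizer of $\sup_a\inf_b f(a,b)$ is a feasible pair $(a^*,b^*)$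 such that $b^*$ attains the infimum at $a^*$ and $a^*$ attains the supremum. For $\theta>0$ with $J^{p,d}(\theta)$ finite, $\partial J^{p,d}(\theta)$ is the set of $\eta\in\mathbb R$ such that $J^{p,d}(\theta')\le J^{p,d}(\theta)+\eta(\theta'-\theta)$ for all $\theta'\ge0$; it is empty if $J^{p,d}(\theta)$ is not finite. **Theorem.** Assume: 1. $U$ is continuous and bounded, and $x\mapsto U(x,y)$ is concave on $\mathcal X$ for every $y\in\mathcal Y$. 2. $\mathcal A$ is convex, and every sequence in $\mathcal A_\mu$ has a subsequence converging weakly to an element of $\mathcal A_\mu$. 3. Either $\varphi'_\infty=\infty$, or $\{(x,y)\in\mathcal X\times\mathcal Y:U(x,y)\le\alpha\}$ is compact for every $\alpha\in\mathbb R$. 4. There is a metric on $\mathcal P(\mathcal X\times\mathcal Y)$, whose topology is at least as fine as that of weak convergence, for which $\Gamma_\mu$ is compact for every $\mu\in\mathcal A_\mu$. Then: (i) For every $\theta\ge0$, the problem $J^{p,d}(\theta)$ has an optimizer $(\mu^*,\gamma^*)$. (ii) For every $\eta\in\bigcup_{\theta>0}\partial J^{p,d}(\theta)$, the problem $J^{c,d}(\eta)$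 has an optimizer $(\mu^*,\gamma^*)$, and the problem $J^c(\eta)$ has an optimizer $(X^*,Y^*)$ whose joint distribution is $\gamma^*$. -/

import Mathlib

open MeasureTheory Set Filter
open scoped NNReal ENNReal

/-- Entropy functions `φ : [0, ∞) → [0, ∞]`. -/
structure IsEntropyFunction (φ : ℝ≥0 → ℝ≥0∞) : Prop where
  convex : ConvexOn ℝ≥0 Set.univ φ
  lsc : LowerSemicontinuous φ
  proper : ∃ s : ℝ≥0, 0 < s ∧ φ s < ∞

/-- The growth rate `φ'_∞ = lim_{s → ∞} φ s / s`. For an entropy function the limit exists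
in `[0, ∞]` by convexity, so it is equal to the upper limit. -/
noncomputable def recession (φ : ℝ≥0 → ℝ≥0∞) : ℝ≥0∞ :=
  limsup (fun s : ℝ≥0 => φ s / (s : ℝ≥0∞)) atTop

/-- The `φ`-divergence `∫ φ(dμ/dν) dν + φ'_∞ · μ^⊥(univ)`, where `μ^⊥` is the singular part in the
Lebesgue decomposition of `μ` with respect to `ν`; `0 * ∞ = 0` in `ℝ≥0∞`. -/
noncomputable def phiDiv {β : Type*} [MeasurableSpace β] (φ : ℝ≥0 → ℝ≥0∞) (μ ν : Measure β) :
    ℝ≥0∞ :=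
  ∫⁻ y, φ (μ.rnDeriv ν y).toNNReal ∂ν + recession φ * μ.singularPart ν Set.univ

/-- The ambiguity set `D_η` of probability measures `ν` with `D_φ(ν, ν₀) ≤ η`. -/
def divBall {β : Type*} [MeasurableSpace β] (φ : ℝ≥0 → ℝ≥0∞) (ν₀ : ProbabilityMeasure β) (η : ℝ) :
    Set (ProbabilityMeasure β) :=
  {ν | ((phiDiv φ (ν : Measure β) (ν₀ : Measure β) : ℝ≥0∞) : EReal) ≤ (η : EReal)}

/-- Value of the max-min problem `sup_{a ∈ S} inf_{b ∈ T a} f a b`. -/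
noncomputable def maxMinValue {A B : Type*} (S : Set A) (T : A → Set B) (f : A → B → EReal) :
    EReal :=
  ⨆ a ∈ S, ⨅ b ∈ T a, f a b

/-- `(a, b)` is an optimizer of `sup_{a ∈ S} inf_{b ∈ T a} f a b`: it is feasible, `b` attains the
inner infimum at `a`, and `a` attains the outer supremum. -/
def IsMaxMinOptimizer {A B : Type*} (S : Set A) (T : A → Set B) (f : A → B → EReal)
    (a : A) (b : B) : Prop :=
  a ∈ S ∧ b ∈ T a ∧ f a b = ⨅ b' ∈ T a, f a b' ∧ ⨅ b' ∈ T a, f a b' = maxMinValue S T f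

/-- The subdifferential at `θ`, in the sense of concave functions, of `g : C → [-∞, ∞]`.
It is empty where `g` is not finite. -/
def concaveSubdifferential (C : Set ℝ) (g : ℝ → EReal) (θ : ℝ) : Set ℝ :=
  {η | ∃ r : ℝ, g θ = (r : EReal) ∧ ∀ θ' ∈ C, g θ' ≤ ((r + η * (θ' - θ) : ℝ) : EReal)}

section Distributional

variable {α β : Type*} [MeasurableSpace α] [MeasurableSpace β]

/-- The set `𝒜_μ` of the distributions of the decisions `X ∈ 𝒜`. -/
def decisionLaws {Ω : Type*} [MeasurableSpace Ω] (P : Measure Ω) (𝒜 : Set (Ω → α)) :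
    Set (ProbabilityMeasure α) :=
  {μ | ∃ X ∈ 𝒜, (μ : Measure α) = P.map X}

/-- `Γ_μ`: joint distributions with first marginal `μ`. -/
def jointLaws (β : Type*) [MeasurableSpace β] (μ : ProbabilityMeasure α) :
    Set (ProbabilityMeasure (α × β)) :=
  {γ | (γ : Measure (α × β)).fst = (μ : Measure α)}

/-- `Π(μ, ν)`: joint distributions with marginals `μ` and `ν`. -/
def couplings (μ : ProbabilityMeasure α) (ν : ProbabilityMeasure β) :
    Set (ProbabilityMeasure (α × β)) :=
  {γ | (γ : Measure (α × β)).fst = (μ : Measure α) ∧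
    (γ : Measure (α × β)).snd = (ν : Measure β)}

/-- Joint distributions `γ ∈ Π(μ, ν)` for some `ν ∈ D_η`. -/
def constrainedJointLaws (φ : ℝ≥0 → ℝ≥0∞) (ν₀ : ProbabilityMeasure β) (η : ℝ)
    (μ : ProbabilityMeasure α) : Set (ProbabilityMeasure (α × β)) :=
  {γ | ∃ ν ∈ divBall φ ν₀ η, γ ∈ couplings μ ν}

/-- The objective `∫ U dγ` of the constrained distributional problem. -/
noncomputable def distObjective (U : α → β → ℝ) (γ : ProbabilityMeasure (α × β)) : EReal :=
  ((∫ p, U p.1 p.2 ∂(γ : Measure (α × β)) : ℝ) : EReal)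

/-- The objective `∫ U dγ + θ D_φ(π₂ γ, ν₀)` of the penalized distributional problem, `θ ≥ 0`. -/
noncomputable def penObjective (φ : ℝ≥0 → ℝ≥0∞) (ν₀ : ProbabilityMeasure β) (U : α → β → ℝ)
    (θ : ℝ) (γ : ProbabilityMeasure (α × β)) : EReal :=
  distObjective U γ +
    ((ENNReal.ofReal θ * phiDiv φ (γ : Measure (α × β)).snd (ν₀ : Measure β) : ℝ≥0∞) : EReal)

/-- The value `J^{p,d}(θ)` of the penalized distributional problem over the set `M` of decision
distributions. -/
noncomputable def Jpd (φ : ℝ≥0 → ℝ≥0∞) (ν₀ : ProbabilityMeasure β) (U : α → β → ℝ)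
    (M : Set (ProbabilityMeasure α)) (θ : ℝ) : EReal :=
  maxMinValue M (jointLaws β) (fun _ γ => penObjective φ ν₀ U θ γ)

/-- `(μ, γ)` is an optimizer of `J^{p,d}(θ)`. -/
def IsJpdOptimizer (φ : ℝ≥0 → ℝ≥0∞) (ν₀ : ProbabilityMeasure β) (U : α → β → ℝ)
    (M : Set (ProbabilityMeasure α)) (θ : ℝ) (μ : ProbabilityMeasure α)
    (γ : ProbabilityMeasure (α × β)) : Prop :=
  IsMaxMinOptimizer M (jointLaws β) (fun _ γ' => penObjective φ ν₀ U θ γ') μ γ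

/-- `(μ, γ)` is an optimizer of the constrained distributional problem `J^{c,d}(η)`. -/
def IsJcdOptimizer (φ : ℝ≥0 → ℝ≥0∞) (ν₀ : ProbabilityMeasure β) (U : α → β → ℝ)
    (M : Set (ProbabilityMeasure α)) (η : ℝ) (μ : ProbabilityMeasure α)
    (γ : ProbabilityMeasure (α × β)) : Prop :=
  IsMaxMinOptimizer M (constrainedJointLaws φ ν₀ η) (fun _ γ' => distObjective U γ') μ γ

end Distributional

section RandomVariables

variable {Ω α β : Type*} [MeasurableSpace α] [MeasurableSpace β]

/-- The admissible environment variables: `𝓗`-measurable `Y : Ω → β` with distribution in `D_η`. -/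
def environments (𝓗 : MeasurableSpace Ω) [MeasurableSpace Ω] (P : Measure Ω) (φ : ℝ≥0 → ℝ≥0∞)
    (ν₀ : ProbabilityMeasure β) (η : ℝ) : Set (Ω → β) :=
  {Y | Measurable[𝓗] Y ∧ ∃ ν ∈ divBall φ ν₀ η, (ν : Measure β) = P.map Y}

/-- `(X, Y)` is an optimizer of the original problem
`J^c(η) = sup_{X ∈ 𝒜} inf_{Y ∼ ν ∈ D_η} E[U(X, Y)]`, with `Y` ranging over the `𝓗`-measurable
variables. -/
def IsJcOptimizer (𝓗 : MeasurableSpace Ω) [MeasurableSpace Ω] (P : Measure Ω) (φ : ℝ≥0 → ℝ≥0∞)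
    (ν₀ : ProbabilityMeasure β) (U : α → β → ℝ) (𝒜 : Set (Ω → α)) (η : ℝ)
    (X : Ω → α) (Y : Ω → β) : Prop :=
  IsMaxMinOptimizer 𝒜 (fun _ => environments 𝓗 P φ ν₀ η)
    (fun X' Y' => ((∫ ω, U (X' ω) (Y' ω) ∂P : ℝ) : EReal)) X Y

end RandomVariables

section Assumptions

variable {n m : ℕ}

/-- `U(x, y)` is concave in `x ∈ 𝒳` for each fixed `y ∈ 𝒴`. -/
def ConcaveInDecision {𝒳 : Set (EuclideanSpace ℝ (Fin n))} {𝒴 : Set (EuclideanSpace ℝ (Fin m))}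
    (U : 𝒳 → 𝒴 → ℝ) : Prop :=
  ∀ (y : 𝒴) (x₁ x₂ x : 𝒳) (t : ℝ), 0 ≤ t → t ≤ 1 →
    (x : EuclideanSpace ℝ (Fin n)) = t • (x₁ : EuclideanSpace ℝ (Fin n)) + (1 - t) • x₂ →
    t * U x₁ y + (1 - t) * U x₂ y ≤ U x y

/-- There is a metric on `𝒫(𝒳 × 𝒴)`, whose convergence implies weak convergence (its topology is
at least as fine as the weak one), for which each `Γ_μ`, `μ ∈ M`, is compact. -/
def MetricallyCompactJointLaws {𝒳 : Set (EuclideanSpace ℝ (Fin n))}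
    (𝒴 : Set (EuclideanSpace ℝ (Fin m))) (M : Set (ProbabilityMeasure 𝒳)) : Prop :=
  ∃ d : MetricSpace (ProbabilityMeasure (𝒳 × 𝒴)),
    d.toPseudoMetricSpace.toUniformSpace.toTopologicalSpace ≤
      (ProbabilityMeasure.instTopologicalSpace : TopologicalSpace (ProbabilityMeasure (𝒳 × 𝒴))) ∧
    ∀ μ ∈ M, @IsCompact _ d.toPseudoMetricSpace.toUniformSpace.toTopologicalSpace
      (jointLaws 𝒴 μ)

end Assumptions

/-! Both distributional problems maximize over `μ` the minimum of `∫ U dγ + Φ(π₂γ)` over `γ ∈ Γ_μ`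
with `π₂γ ∈ N`, where `N` is weakly closed and `Φ` is lower semicontinuous: `Φ = θ D_φ` with `N`
everything, or `Φ = 0` with `N = D_η`. `exists_isMaxMinOptimizer_jointLaws` solves this form once.
The inner minimum exists because `Γ_μ` is weakly compact.

For the outer maximum, the value is upper semicontinuous along `μ_k → μ`. By
`eventually_exists_jointLaw_integral_le`, an optimal `γ` for `μ` can be moved to first marginal
`μ_k` with the second marginal kept exactly and `∫ U` raised by at most `ε`. Hence neither `Φ` nor
the constraint changes, although `Φ` need not be continuous.

Two facts about the divergence are needed. It is weakly lower semicontinuous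
(`lowerSemicontinuous_phiDiv`), being a supremum of pairings `∫ g dν + ∫ h dν₀` with `(g, h)`
continuous, bounded and affine-minorant valued. And `D_η` is nonempty when `η` is a subgradient,
since the penalized value grows at least like `θ` times the least divergence.

Finally, a uniform variable independent of `X` realizes every `γ ∈ Γ_μ` as the law of some `(X, Y)`,
so `J^c` and `J^{c,d}` have the same inner values. -/

/-! ### Couplings with a changed first marginal -/

section Coupling

open scoped Topology

variable {X Y : Type*} [MeasurableSpace X] [MeasurableSpace Y]

/-- A measure whose marginals are dominated by `μ` and `ν` extends to a coupling of `μ` and `ν`. -/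
theorem exists_coupling_of_marginals_le (π : Measure (X × Y)) (μ : Measure X) (ν : Measure Y)
    [IsProbabilityMeasure μ] [IsProbabilityMeasure ν] (h₁ : π.fst ≤ μ) (h₂ : π.snd ≤ ν) :
    ∃ r : Measure (X × Y), r univ = 1 - π univ ∧ (π + r).fst = μ ∧ (π + r).snd = ν := by
  have hπ : π univ ≤ 1 := by
    rw [← Measure.fst_univ]
    exact (h₁ univ).trans_eq measure_univ
  have : IsFiniteMeasure π := ⟨hπ.trans_lt ENNReal.one_lt_top⟩
  set ρ := μ - π.fst with hρ
  set κ := ν - π.snd with hκ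
  have hρm : ρ univ = 1 - π univ := by
    rw [hρ, Measure.sub_apply .univ h₁, measure_univ, Measure.fst_univ]
  have hκm : κ univ = 1 - π univ := by
    rw [hκ, Measure.sub_apply .univ h₂, measure_univ, Measure.snd_univ]
  set m := 1 - π univ with hm
  have hm_top : m ≠ ∞ := ((tsub_le_self).trans_lt ENNReal.one_lt_top).ne
  -- If `m = 0` then `m⁻¹ = ∞`, but the deficits `ρ` and `κ` vanish too, so their normalized product
  -- is still the right filler.
  have key : ∀ a : ℝ≥0∞, a ≤ m → m⁻¹ * (m * a) = a := fun a ha => by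
    rcases eq_or_ne m 0 with h0 | h0
    · simp [le_antisymm (ha.trans_eq h0) zero_le]
    · rw [← mul_assoc, ENNReal.inv_mul_cancel h0 hm_top, one_mul]
  have hf : (m⁻¹ • ρ.prod κ).fst = ρ := by
    rw [Measure.fst, Measure.map_smul, Measure.map_fst_prod, hκm]
    ext s _
    simpa using key _ ((measure_mono (subset_univ s)).trans_eq hρm)
  have hs : (m⁻¹ • ρ.prod κ).snd = κ := by
    rw [Measure.snd, Measure.map_smul, Measure.map_snd_prod, hρm]
    ext s _
    simpa using key _ ((measure_mono (subset_univ s)).trans_eq hκm)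
  refine ⟨m⁻¹ • ρ.prod κ, ?_, ?_, ?_⟩
  · rw [← Measure.fst_univ, hf, hρm]
  · rw [Measure.fst_add, hf, add_comm, hρ, Measure.sub_add_cancel_of_le h₁]
  · rw [Measure.snd_add, hs, add_comm, hκ, Measure.sub_add_cancel_of_le h₂]

theorem Measure.fst_finset_sum {ι : Type*} (s : Finset ι) (π : ι → Measure (X × Y)) :
    (∑ i ∈ s, π i).fst = ∑ i ∈ s, (π i).fst := by
  ext t ht
  simp [Measure.fst_apply ht, Measure.finsetSum_apply]

theorem Measure.snd_finset_sum {ι : Type*} (s : Finset ι) (π : ι → Measure (X × Y)) :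
    (∑ i ∈ s, π i).snd = ∑ i ∈ s, (π i).snd := by
  ext t ht
  simp [Measure.snd_apply ht, Measure.finsetSum_apply]

theorem Measure.sum_restrict_le {α ι : Type*} [MeasurableSpace α] (s : Finset ι) (A : ι → Set α)
    (hA : ∀ i ∈ s, MeasurableSet (A i)) (hd : (s : Set ι).PairwiseDisjoint A) (μ : Measure α) :
    ∑ i ∈ s, μ.restrict (A i) ≤ μ := by
  refine Measure.le_iff.2 fun t ht => ?_
  rw [Measure.finsetSum_apply]
  calc ∑ i ∈ s, μ.restrict (A i) t = ∑ i ∈ s, μ.restrict t (A i) := by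
        refine Finset.sum_congr rfl fun i hi => ?_
        rw [Measure.restrict_apply ht, Measure.restrict_apply (hA i hi), inter_comm]
    _ = μ.restrict t (⋃ i ∈ s, A i) := (measure_biUnion_finset hd hA).symm
    _ ≤ μ t := (measure_mono (subset_univ _)).trans_eq (Measure.restrict_apply_univ _)

/-- Transport of the first marginal of `γ` to `μ'` along the cells of a finite partition, with the
second marginal unchanged. -/
theorem exists_coupling_lintegral_le {ι : Type*} (s : Finset ι) (A : ι → Set X)
    (hA : ∀ i ∈ s, MeasurableSet (A i)) (hd : (s : Set ι).PairwiseDisjoint A)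
    (μ' : Measure X) [IsProbabilityMeasure μ'] (γ : Measure (X × Y)) [IsProbabilityMeasure γ]
    (u : X × Y → ℝ≥0∞) (hu : Measurable u) (M : ℝ≥0∞) (huM : ∀ p, u p ≤ M)
    (g : Y → ℝ≥0∞) (hg : Measurable g)
    (hug : ∀ i ∈ s, ∀ x ∈ A i, ∀ x' ∈ A i, ∀ y, u (x, y) ≤ u (x', y) + g y) :
    ∃ γ' : Measure (X × Y), γ'.fst = μ' ∧ γ'.snd = γ.snd ∧
      ∫⁻ p, u p ∂γ' ≤ ∫⁻ p, u p ∂γ + ∫⁻ y, g y ∂γ.snd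
        + M * (1 - ∑ i ∈ s, min (γ.fst (A i)) (μ' (A i))) := by
  set a : ι → ℝ≥0∞ := fun i => γ.fst (A i) with ha
  set b : ι → ℝ≥0∞ := fun i => μ' (A i) with hb
  -- With this weight the piece of cell `i` has mass `min (a i) (b i)`, the most that keeps both
  -- marginals dominated.
  set t : ι → ℝ≥0∞ := fun i => (max (a i) (b i))⁻¹ with ht
  have hab_top : ∀ i, max (a i) (b i) ≠ ∞ := fun i =>
    (max_lt (measure_lt_top _ _) (measure_lt_top _ _)).ne
  have hta : ∀ i, t i * a i ≤ 1 := fun i =>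
    (mul_le_mul_right (le_max_left _ _) _).trans (ENNReal.inv_mul_le_one _)
  have htb : ∀ i, t i * b i ≤ 1 := fun i =>
    (mul_le_mul_right (le_max_right _ _) _).trans (ENNReal.inv_mul_le_one _)
  have htab : ∀ i, t i * (a i * b i) = min (a i) (b i) := fun i => by
    rw [← max_mul_min (a i) (b i), ← mul_assoc]
    rcases eq_or_ne (max (a i) (b i)) 0 with h | h
    · have : min (a i) (b i) = 0 := le_antisymm (min_le_max.trans_eq h) zero_le
      simp [this]
    · rw [ENNReal.inv_mul_cancel h (hab_top i), one_mul]
  set B : ι → Set (X × Y) := fun i => Prod.fst ⁻¹' A i with hB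
  have hBm : ∀ i ∈ s, MeasurableSet (B i) := fun i hi => measurable_fst (hA i hi)
  have hBd : (s : Set ι).PairwiseDisjoint B := fun i hi j hj hij =>
    (hd hi hj hij).preimage Prod.fst
  have hγB : ∀ i ∈ s, γ (B i) = a i := fun i hi => (Measure.fst_apply (hA i hi)).symm
  set ρ : ι → Measure Y := fun i => (γ.restrict (B i)).snd with hρ
  have hρm : ∀ i ∈ s, ρ i univ = a i := fun i hi => by
    rw [hρ, Measure.snd_univ, Measure.restrict_apply_univ, hγB i hi]
  -- Inside a cell the dependence between the coordinates is discarded. Since `u` varies there by at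
  -- most `g`, this costs `∫ g`; the mass left over costs at most `M` per unit.
  set π : Measure (X × Y) := ∑ i ∈ s, t i • (μ'.restrict (A i)).prod (ρ i) with hπ
  have hπm : π univ = ∑ i ∈ s, min (a i) (b i) := by
    rw [hπ, Measure.finsetSum_apply]
    refine Finset.sum_congr rfl fun i hi => ?_
    rw [Measure.smul_apply, ← univ_prod_univ, Measure.prod_prod, hρm i hi,
      Measure.restrict_apply_univ, smul_eq_mul, mul_comm (μ' _), htab]
  have h₁ : π.fst ≤ μ' := by
    rw [hπ, Measure.fst_finset_sum]
    refine le_trans (Finset.sum_le_sum fun i hi => ?_) (Measure.sum_restrict_le s A hA hd μ')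
    rw [Measure.fst, Measure.map_smul, Measure.map_fst_prod, hρm i hi, smul_smul]
    refine Measure.le_iff.2 fun u _ => ?_
    simpa using mul_le_mul_left (hta i) (μ'.restrict (A i) u)
  have h₂ : π.snd ≤ γ.snd := by
    refine le_trans ?_ (Measure.map_mono (Measure.sum_restrict_le s B hBm hBd γ) measurable_snd)
    rw [← Measure.snd, hπ, Measure.snd_finset_sum, Measure.snd_finset_sum]
    refine Finset.sum_le_sum fun i hi => ?_
    rw [Measure.snd, Measure.map_smul, Measure.map_snd_prod, Measure.restrict_apply_univ, smul_smul]
    refine Measure.le_iff.2 fun u _ => ?_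
    simpa using mul_le_mul_left (htb i) (ρ i u)
  have hπu : ∫⁻ p, u p ∂π ≤ ∫⁻ p, u p ∂γ + ∫⁻ y, g y ∂γ.snd := by
    have hgs : Measurable fun p : X × Y => g p.2 := hg.comp measurable_snd
    calc ∫⁻ p, u p ∂π = ∑ i ∈ s, t i * ∫⁻ p, u p ∂(μ'.restrict (A i)).prod (ρ i) := by
          rw [hπ, lintegral_finsetSum_measure]
          simp only [lintegral_smul_measure, smul_eq_mul]
      _ ≤ ∑ i ∈ s, ∫⁻ p in B i, u p + g p.2 ∂γ := by
          refine Finset.sum_le_sum fun i hi => ?_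
          have h : ∫⁻ p, u p ∂(μ'.restrict (A i)).prod (ρ i)
              ≤ b i * ∫⁻ p in B i, u p + g p.2 ∂γ := by
            rw [lintegral_prod_symm _ hu.aemeasurable,
              show ρ i = (γ.restrict (B i)).map Prod.snd from rfl,
              lintegral_map (by exact hu.lintegral_prod_left') measurable_snd,
              ← lintegral_const_mul (f := fun p => u p + g p.2) _ (hu.add hgs)]
            refine setLIntegral_mono' (hBm i hi) fun q hq => ?_
            rw [mul_comm, hb, ← setLIntegral_const]
            exact setLIntegral_mono' (hA i hi) fun x hx => hug i hi x hx q.1 hq q.2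
          calc _ ≤ t i * (b i * ∫⁻ p in B i, u p + g p.2 ∂γ) := mul_le_mul_right h _
            _ = t i * b i * ∫⁻ p in B i, u p + g p.2 ∂γ := (mul_assoc _ _ _).symm
            _ ≤ _ := mul_le_of_le_one_left zero_le (htb i)
      _ = ∫⁻ p in ⋃ i ∈ s, B i, u p + g p.2 ∂γ := (lintegral_biUnion_finset hBd hBm _).symm
      _ ≤ ∫⁻ p, u p + g p.2 ∂γ := setLIntegral_le_lintegral _ _
      _ = _ := by rw [lintegral_add_left hu, Measure.snd, lintegral_map hg measurable_snd]
  obtain ⟨r, hr, hr₁, hr₂⟩ := exists_coupling_of_marginals_le π μ' γ.snd h₁ h₂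
  refine ⟨π + r, hr₁, hr₂, ?_⟩
  rw [lintegral_add_measure, ← hπm, ← hr]
  refine add_le_add hπu ((lintegral_mono huM).trans_eq ?_)
  rw [lintegral_const]

end Coupling

/-! ### Partitions into continuity sets -/

section Partition

open scoped Topology

variable {X : Type*} [PseudoMetricSpace X] [SecondCountableTopology X] [MeasurableSpace X]
  [OpensMeasurableSpace X]

/-- Every neighbourhood assignment is refined by a countable partition with null frontiers. -/
theorem exists_partition_null_frontier (μ : Measure X) [IsFiniteMeasure μ] (V : X → Set X)
    (hV : ∀ x, V x ∈ 𝓝 x) :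
    ∃ A : ℕ → Set X, (∀ i, MeasurableSet (A i)) ∧ Pairwise (Function.onFun Disjoint A) ∧
      (∀ i, μ (frontier (A i)) = 0) ∧ (∀ i, (A i).Nonempty → ∃ x, A i ⊆ V x) ∧
      ⋃ i, A i = univ := by
  have h : ∀ x, ∃ B ∈ 𝓝 x, B ⊆ V x ∧ IsOpen B ∧ μ (frontier B) = 0 := fun x => by
    obtain ⟨r, hr, hrV⟩ := Metric.mem_nhds_iff.1 (hV x)
    obtain ⟨r', hr', hf⟩ := exists_null_frontier_thickening μ {x} hr
    rw [Metric.thickening_singleton] at hf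
    exact ⟨_, Metric.ball_mem_nhds x hr'.1, (Metric.ball_subset_ball hr'.2.le).trans hrV,
      Metric.isOpen_ball, hf⟩
  choose B hB hBV hBo hBf using h
  obtain ⟨s, hs, hcov⟩ := TopologicalSpace.countable_cover_nhds hB
  have hb : ∃ C : ℕ → Set X, (∀ i, MeasurableSet (C i) ∧ μ (frontier (C i)) = 0 ∧
      ((C i).Nonempty → ∃ x, C i ⊆ V x)) ∧ ⋃ i, C i = univ := by
    rcases s.eq_empty_or_nonempty with rfl | hne
    · exact ⟨fun _ => ∅, by simp, by simpa using hcov⟩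
    · obtain ⟨f, rfl⟩ := hs.exists_eq_range hne
      exact ⟨fun i => B (f i), fun i => ⟨(hBo _).measurableSet, hBf _, fun _ => ⟨_, hBV _⟩⟩,
        by simpa using hcov⟩
  obtain ⟨C, hC, hCu⟩ := hb
  refine ⟨disjointed C, fun i => MeasurableSet.disjointed (fun i => (hC i).1) i,
    disjoint_disjointed C, fun i => ?_, fun i hi => ?_, by rw [iUnion_disjointed, hCu]⟩
  -- Each cell arises by finitely many set differences, and the frontier of a difference lies in the
  -- union of the two frontiers.
  · refine disjointedRec (p := fun A => μ (frontier A) = 0) (fun {t j} ht => ?_) (hC i).2.1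
    refine measure_mono_null ?_ (measure_union_null ht (hC j).2.1)
    rw [sdiff_eq]
    refine (frontier_inter_subset _ _).trans (union_subset_union inter_subset_left ?_)
    rw [frontier_compl]
    exact inter_subset_right
  · obtain ⟨x, hx⟩ := (hC i).2.2 (hi.mono (disjointed_subset C i))
    exact ⟨x, (disjointed_subset C i).trans hx⟩

end Partition

/-! ### Stability of joint laws under weak convergence of the first marginal -/

section Gluing

open scoped Topology

variable {X Y : Type*} [MetricSpace X] [SecondCountableTopology X] [MeasurableSpace X]
  [BorelSpace X] [MetricSpace Y] [CompleteSpace Y] [SecondCountableTopology Y] [MeasurableSpace Y]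
  [BorelSpace Y]

/-- Tightness of the second marginal gives a compact `K` over which `U` oscillates little in `x` on
small cells. Finitely many such cells carry almost all of `μ`, and their null frontiers make `μs k
(A i)` converge to `μ (A i)`, so almost all mass can be moved within cells. Adding `C` to `U` makes
the integrand nonnegative and bounded by `2 * C`. -/
theorem eventually_exists_coupling_lintegral_le (U : X → Y → ℝ)
    (hU : Continuous (Function.uncurry U)) {C : ℝ} (hC₀ : 0 ≤ C) (hC : ∀ x y, |U x y| ≤ C)
    {μs : ℕ → ProbabilityMeasure X} {μ : ProbabilityMeasure X} (hμ : Tendsto μs atTop (𝓝 μ))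
    (γ : Measure (X × Y)) [IsProbabilityMeasure γ] (hγ : γ.fst = μ) {ε : ℝ} (hε : 0 < ε) :
    ∀ᶠ k in atTop, ∃ γ' : Measure (X × Y), γ'.fst = μs k ∧ γ'.snd = γ.snd ∧
      ∫⁻ p, ENNReal.ofReal (U p.1 p.2 + C) ∂γ' ≤
        ∫⁻ p, ENNReal.ofReal (U p.1 p.2 + C) ∂γ + ENNReal.ofReal ε := by
  -- Mass `κ` then costs at most `ε / 4`; the `+ 1` covers `C = 0`. Three errors of this size occur:
  -- oscillation over `K`, mass off `K`, mass not transported.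
  set κ : ℝ := ε / (4 * (2 * C + 1)) with hκ
  have hκ₀ : 0 < κ := by positivity
  have hκε : ENNReal.ofReal (2 * C) * ENNReal.ofReal κ ≤ ENNReal.ofReal (ε / 4) := by
    rw [← ENNReal.ofReal_mul (by positivity)]
    refine ENNReal.ofReal_le_ofReal ?_
    rw [hκ, mul_div_assoc', div_le_div_iff₀ (by positivity) (by positivity)]
    nlinarith
  obtain ⟨K, hK, hKν⟩ := (isTightMeasureSet_iff_exists_isCompact_measure_compl_le.1
    (isTightMeasureSet_singleton (μ := γ.snd))) (ENNReal.ofReal κ) (by simpa using hκ₀)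
  replace hKν := hKν _ rfl
  have hV : ∀ x, {x' | ∀ y ∈ K, |U x' y - U x y| < ε / 8} ∈ 𝓝 x := fun x => by
    refine hK.eventually_forall_of_forall_eventually fun y _ => ?_
    have hc : Continuous fun z : X × Y => |U z.1 z.2 - U x z.2| := by
      have h1 : Continuous fun z : X × Y => U z.1 z.2 := hU
      have h2 : Continuous fun z : X × Y => U x z.2 :=
        hU.comp (continuous_const.prodMk continuous_snd)
      exact (h1.sub h2).abs
    exact hc.continuousAt.eventually_lt continuousAt_const (by simpa using by positivity)
  obtain ⟨A, hA, hAd, hAf, hAV, hAu⟩ := exists_partition_null_frontier (μ : Measure X) _ hV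
  have hsum : Tendsto (fun N => 1 - ∑ i ∈ Finset.range N, (μ : Measure X) (A i)) atTop (𝓝 0) := by
    have h := ENNReal.tendsto_nat_tsum fun i => (μ : Measure X) (A i)
    rw [← measure_iUnion hAd hA, hAu, measure_univ] at h
    simpa using ENNReal.Tendsto.sub tendsto_const_nhds h (Or.inl ENNReal.one_ne_top)
  obtain ⟨N, hN⟩ := (hsum.eventually (gt_mem_nhds (ENNReal.ofReal_pos.2 hκ₀))).exists
  have hlim : Tendsto (fun k => 1 - ∑ i ∈ Finset.range N,
      min ((μ : Measure X) (A i)) ((μs k : Measure X) (A i))) atTop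
      (𝓝 (1 - ∑ i ∈ Finset.range N, (μ : Measure X) (A i))) := by
    refine ENNReal.Tendsto.sub tendsto_const_nhds (tendsto_finsetSum _ fun i _ => ?_)
      (Or.inl ENNReal.one_ne_top)
    simpa using (tendsto_const_nhds (x := (μ : Measure X) (A i))).min
      (ProbabilityMeasure.tendsto_measure_of_null_frontier_of_tendsto' hμ (hAf i))
  filter_upwards [hlim.eventually (gt_mem_nhds hN)] with k hk
  set M := ENNReal.ofReal (2 * C)
  set g : Y → ℝ≥0∞ := fun y => ENNReal.ofReal (ε / 4) + Kᶜ.indicator (fun _ => M) y with hg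
  have hKm : MeasurableSet Kᶜ := hK.isClosed.measurableSet.compl
  have hgm : Measurable g := (measurable_const.indicator hKm).const_add _
  have hum : Measurable fun p : X × Y => ENNReal.ofReal (U p.1 p.2 + C) :=
    ((hU.measurable).add_const C).ennreal_ofReal
  obtain ⟨γ', h₁, h₂, h₃⟩ := exists_coupling_lintegral_le (Finset.range N) A (fun i _ => hA i)
    (fun i _ j _ hij => hAd hij) (μs k : Measure X) γ _ hum M
    (fun p => ENNReal.ofReal_le_ofReal (by linarith [(abs_le.1 (hC p.1 p.2)).2])) g hgm (by
      intro i _ x hx x' hx' y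
      by_cases hy : y ∈ K
      · obtain ⟨z, hz⟩ := hAV i ⟨x, hx⟩
        have e1 := abs_lt.1 (hz hx y hy)
        have e2 := abs_lt.1 (hz hx' y hy)
        simp only [hg, indicator_of_notMem (show y ∉ Kᶜ by simpa using hy), add_zero]
        rw [← ENNReal.ofReal_add (by linarith [(abs_le.1 (hC x' y)).1]) (by positivity)]
        exact ENNReal.ofReal_le_ofReal (by linarith [e1.2, e2.1])
      · simp only [hg, indicator_of_mem (show y ∈ Kᶜ from hy)]
        refine le_add_left (le_add_left (ENNReal.ofReal_le_ofReal ?_))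
        linarith [(abs_le.1 (hC x y)).2])
  refine ⟨γ', h₁, h₂, h₃.trans ?_⟩
  rw [hγ, add_assoc]
  refine add_le_add le_rfl ?_
  have hgi : ∫⁻ y, g y ∂γ.snd ≤ ENNReal.ofReal (ε / 4) + ENNReal.ofReal (ε / 4) := by
    rw [hg, lintegral_add_left measurable_const, lintegral_const, measure_univ, mul_one,
      lintegral_indicator_const hKm]
    exact add_le_add le_rfl ((mul_le_mul_right hKν _).trans hκε)
  calc _ ≤ (ENNReal.ofReal (ε / 4) + ENNReal.ofReal (ε / 4)) + ENNReal.ofReal (ε / 4) :=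
        add_le_add hgi ((mul_le_mul_right hk.le _).trans hκε)
    _ ≤ ENNReal.ofReal ε := by
        rw [← ENNReal.ofReal_add (by positivity) (by positivity),
          ← ENNReal.ofReal_add (by positivity) (by positivity)]
        exact ENNReal.ofReal_le_ofReal (by linarith)

theorem integrable_of_continuous_of_abs_le {Z : Type*} [TopologicalSpace Z] [MeasurableSpace Z]
    [OpensMeasurableSpace Z] {f : Z → ℝ} (hf : Continuous f) {C : ℝ} (hC : ∀ z, |f z| ≤ C)
    (γ : Measure Z) [IsFiniteMeasure γ] : Integrable f γ :=
  Integrable.of_bound hf.measurable.aestronglyMeasurable C (Eventually.of_forall hC)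

/-- If `μs k → μ` weakly, a joint law with first marginal `μ` is approximated in the objective by
joint laws with first marginals `μs k` and the same second marginal. -/
theorem eventually_exists_jointLaw_integral_le (U : X → Y → ℝ)
    (hU : Continuous (Function.uncurry U)) {C : ℝ} (hC₀ : 0 ≤ C) (hC : ∀ x y, |U x y| ≤ C)
    {μs : ℕ → ProbabilityMeasure X} {μ : ProbabilityMeasure X} (hμ : Tendsto μs atTop (𝓝 μ))
    {γ : ProbabilityMeasure (X × Y)} (hγ : γ ∈ jointLaws Y μ) {ε : ℝ} (hε : 0 < ε) :
    ∀ᶠ k in atTop, ∃ γ' ∈ jointLaws Y (μs k),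
      (γ' : Measure (X × Y)).snd = (γ : Measure (X × Y)).snd ∧
      ∫ p, U p.1 p.2 ∂(γ' : Measure (X × Y)) ≤ ∫ p, U p.1 p.2 ∂(γ : Measure (X × Y)) + ε := by
  filter_upwards [eventually_exists_coupling_lintegral_le U hU hC₀ hC hμ (γ : Measure (X × Y)) hγ
    hε] with k ⟨γ', h₁, h₂, h₃⟩
  have hp : IsProbabilityMeasure γ' := ⟨by rw [← Measure.fst_univ, h₁, measure_univ]⟩
  refine ⟨⟨γ', hp⟩, h₁, h₂, ?_⟩
  have hi : ∀ (ρ : Measure (X × Y)) [IsProbabilityMeasure ρ],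
      Integrable (fun p : X × Y => U p.1 p.2) ρ := fun ρ _ =>
    integrable_of_continuous_of_abs_le hU (fun p => hC p.1 p.2) ρ
  have key : ∀ (ρ : Measure (X × Y)) [IsProbabilityMeasure ρ],
      ∫⁻ p, ENNReal.ofReal (U p.1 p.2 + C) ∂ρ = ENNReal.ofReal (∫ p, U p.1 p.2 ∂ρ + C) ∧
        0 ≤ ∫ p, U p.1 p.2 ∂ρ + C := fun ρ _ => by
    have hnn : ∀ p : X × Y, 0 ≤ U p.1 p.2 + C := fun p => by
      linarith [(abs_le.1 (hC p.1 p.2)).1]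
    have he : ∫ p, U p.1 p.2 ∂ρ + C = ∫ p, U p.1 p.2 + C ∂ρ := by
      rw [integral_add (hi ρ) (integrable_const C)]
      simp
    rw [he]
    exact ⟨(ofReal_integral_eq_lintegral_ofReal ((hi ρ).add (integrable_const C))
      (Eventually.of_forall hnn)).symm, integral_nonneg hnn⟩
  rw [(key γ').1, (key _).1, ← ENNReal.ofReal_add (key _).2 hε.le,
    ENNReal.ofReal_le_ofReal_iff (add_nonneg (key _).2 hε.le)] at h₃
  change ∫ p, U p.1 p.2 ∂γ' ≤ _
  linarith

end Gluing

/-! ### Entropy functions as suprema of affine minorants -/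

section AffineMinorants

open scoped Topology

/-- The pairs `(a, b)` for which `s ↦ a s + b` is a minorant of `φ` on `[0, ∞)`. -/
def affineMinorants (φ : ℝ≥0 → ℝ≥0∞) : Set (ℝ × ℝ) :=
  {e | ∀ s : ℝ≥0, ENNReal.ofReal (e.1 * s + e.2) ≤ φ s}

theorem zero_mem_affineMinorants (φ : ℝ≥0 → ℝ≥0∞) : (0 : ℝ × ℝ) ∈ affineMinorants φ := by
  intro s
  simp

theorem mem_affineMinorants_iff {φ : ℝ≥0 → ℝ≥0∞} {e : ℝ × ℝ} :
    e ∈ affineMinorants φ ↔ ∀ s : ℝ≥0, φ s ≠ ∞ → e.1 * s + e.2 ≤ (φ s).toReal := by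
  refine forall_congr' fun s => ?_
  by_cases h : φ s = ∞
  · simp [h]
  · simp [h, ENNReal.ofReal_le_iff_le_toReal h]

/-- This is what allows continuous interpolation between minorants when simple functions are
smoothed. -/
theorem convex_affineMinorants (φ : ℝ≥0 → ℝ≥0∞) : Convex ℝ (affineMinorants φ) := by
  intro e he e' he' a b ha hb hab
  rw [mem_affineMinorants_iff] at *
  intro s hs
  have h1 := mul_le_mul_of_nonneg_left (he s hs) ha
  have h2 := mul_le_mul_of_nonneg_left (he' s hs) hb
  have h3 : (φ s).toReal = a * (φ s).toReal + b * (φ s).toReal := by rw [← add_mul, hab, one_mul]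
  rw [h3]
  simp only [Prod.fst_add, Prod.smul_fst, Prod.snd_add, Prod.smul_snd, smul_eq_mul]
  linarith

/-- Hahn–Banach separates `(s₀, c)` from the closed convex epigraph in the plane. A non-vertical
separating line is itself the minorant. -/
theorem IsEntropyFunction.exists_affineMinorant {φ : ℝ≥0 → ℝ≥0∞} (hφ : IsEntropyFunction φ)
    (s₀ : ℝ≥0) {c : ℝ} (hc₀ : 0 ≤ c) (hc : ENNReal.ofReal c < φ s₀) :
    ∃ e ∈ affineMinorants φ, c ≤ e.1 * s₀ + e.2 := by
  set G : Set (ℝ × ℝ) := {p | 0 ≤ p.1 ∧ 0 ≤ p.2 ∧ φ p.1.toNNReal ≤ ENNReal.ofReal p.2} with hG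
  have hGc : IsClosed G := by
    refine (isClosed_le continuous_const continuous_fst).inter
      ((isClosed_le continuous_const continuous_snd).inter ?_)
    have h := hφ.lsc.isClosed_epigraph
    exact h.preimage (((continuous_real_toNNReal.comp continuous_fst)).prodMk
      (ENNReal.continuous_ofReal.comp continuous_snd))
  have hGv : Convex ℝ G := by
    rintro ⟨s, t⟩ ⟨hs, ht, h⟩ ⟨s', t'⟩ ⟨hs', ht', h'⟩ a b ha hb hab
    refine ⟨by simp only [Prod.fst_add, Prod.smul_fst, smul_eq_mul]; positivity,
      by simp only [Prod.snd_add, Prod.smul_snd, smul_eq_mul]; positivity, ?_⟩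
    lift a to ℝ≥0 using ha
    lift b to ℝ≥0 using hb
    dsimp only at hs ht hs' ht' h h'
    lift s to ℝ≥0 using hs
    lift s' to ℝ≥0 using hs'
    lift t to ℝ≥0 using ht
    lift t' to ℝ≥0 using ht'
    have hcv := hφ.convex.2 (mem_univ s) (mem_univ s') (zero_le (a := a)) (zero_le (a := b))
      (by exact_mod_cast hab)
    simp only [Real.toNNReal_coe, ENNReal.ofReal_coe_nnreal] at h h'
    have e1 : ((a : ℝ) • ((s : ℝ), (t : ℝ)) + (b : ℝ) • ((s' : ℝ), (t' : ℝ))).1.toNNReal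
        = a • s + b • s' := by
      rw [← NNReal.coe_inj, Real.coe_toNNReal _ (by simp; positivity)]
      simp
    have e2 : ENNReal.ofReal ((a : ℝ) • ((s : ℝ), (t : ℝ)) + (b : ℝ) • ((s' : ℝ), (t' : ℝ))).2
        = a * t + b * t' := by
      rw [← ENNReal.coe_mul, ← ENNReal.coe_mul, ← ENNReal.coe_add, ← ENNReal.ofReal_coe_nnreal]
      simp
    rw [e1, e2]
    refine hcv.trans ?_
    simp only [ENNReal.smul_def, smul_eq_mul]
    gcongr
  have hnot : ((s₀ : ℝ), c) ∉ G := fun h => by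
    have := h.2.2
    simp only [Real.toNNReal_coe] at this
    exact absurd hc this.not_gt
  obtain ⟨f, u, hfu, huf⟩ := geometric_hahn_banach_closed_point hGv hGc hnot
  set α := f (1, 0) with hα
  set β := f (0, 1) with hβ
  have hf : ∀ s t : ℝ, f (s, t) = α * s + β * t := fun s t => by
    have : ((s, t) : ℝ × ℝ) = s • (1, 0) + t • (0, 1) := by simp
    rw [this, map_add, map_smul, map_smul, smul_eq_mul, smul_eq_mul, mul_comm, mul_comm t]
  have hmem : ∀ s : ℝ≥0, φ s ≠ ∞ → ∀ t : ℝ, (φ s).toReal ≤ t → α * s + β * t < u :=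
    fun s hs t ht => by
      rw [← hf]
      refine hfu _ ⟨s.2, ENNReal.toReal_nonneg.trans ht, ?_⟩
      simp only [Real.toNNReal_coe]
      exact (ENNReal.le_ofReal_iff_toReal_le hs (ENNReal.toReal_nonneg.trans ht)).2 ht
  rw [hf] at huf
  obtain ⟨s₁, -, hs₁⟩ := hφ.proper
  have hβ₀ : β ≤ 0 := by
    by_contra! hpos
    have h := hmem s₁ hs₁.ne (max (φ s₁).toReal ((u - α * s₁) / β)) (le_max_left _ _)
    have h2 := mul_le_mul_of_nonneg_left (le_max_right (φ s₁).toReal ((u - α * s₁) / β)) hpos.le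
    rw [mul_div_cancel₀ _ hpos.ne'] at h2
    linarith
  rcases hβ₀.eq_or_lt with h0 | hneg
  -- Vertical line: `α s - u` is negative wherever `φ` is finite and positive at `s₀`, so any
  -- nonnegative multiple is a minorant, and `N` scales it to the value `c` at `s₀`.
  · have hpos : 0 < α * s₀ - u := by rw [h0] at huf; linarith
    set N := c / (α * s₀ - u) with hN
    have hN₀ : 0 ≤ N := div_nonneg hc₀ hpos.le
    refine ⟨(N * α, -(N * u)), mem_affineMinorants_iff.2 fun s hs => ?_, ?_⟩
    · have h := hmem s hs _ le_rfl
      rw [h0] at h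
      have h2 : N * (α * s - u) ≤ 0 := mul_nonpos_of_nonneg_of_nonpos hN₀ (by linarith)
      refine le_trans ?_ (ENNReal.toReal_nonneg (a := φ s))
      dsimp only
      linarith
    · have h2 : N * (α * s₀ - u) = c := div_mul_cancel₀ _ hpos.ne'
      dsimp only
      linarith
  · have hb : 0 < -β := by linarith
    refine ⟨(α / -β, -u / -β), mem_affineMinorants_iff.2 fun s hs => ?_, ?_⟩
    · have h := hmem s hs _ le_rfl
      have e : α / -β * (s : ℝ) + -u / -β = (α * s - u) / -β := by ring
      dsimp only
      rw [e, div_le_iff₀ hb]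
      linarith
    · have e : α / -β * (s₀ : ℝ) + -u / -β = (α * s₀ - u) / -β := by ring
      dsimp only
      rw [e, le_div_iff₀ hb]
      linarith

theorem IsEntropyFunction.eq_iSup_affineMinorants {φ : ℝ≥0 → ℝ≥0∞} (hφ : IsEntropyFunction φ)
    (s : ℝ≥0) : φ s = ⨆ e : affineMinorants φ, ENNReal.ofReal (e.1.1 * s + e.1.2) := by
  refine le_antisymm (le_of_forall_lt fun c hc => ?_) (iSup_le fun e => e.2 s)
  obtain ⟨d, hcd, hd⟩ := exists_between hc
  have hdt : d ≠ ∞ := (hd.trans_le le_top).ne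
  obtain ⟨e, he, hce⟩ := hφ.exists_affineMinorant s (c := d.toReal) ENNReal.toReal_nonneg
    (by rwa [ENNReal.ofReal_toReal hdt])
  refine hcd.trans_le (le_trans ?_ (le_iSup _ (⟨e, he⟩ : affineMinorants φ)))
  rw [← ENNReal.ofReal_toReal hdt]
  exact ENNReal.ofReal_le_ofReal hce

/-- Beyond a point `t` where `φ` is finite, no minorant rises faster than the supremum `A` of the
slopes, so `φ s ≤ φ t + A * s`. Conversely, each minorant divided by `s` tends to its slope. -/
theorem IsEntropyFunction.recession_eq_iSup {φ : ℝ≥0 → ℝ≥0∞} (hφ : IsEntropyFunction φ) :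
    recession φ = ⨆ e : affineMinorants φ, ENNReal.ofReal e.1.1 := by
  have htop : Tendsto (fun s : ℝ≥0 => (s : ℝ≥0∞)) atTop (𝓝 ∞) :=
    ENNReal.tendsto_coe_nhds_top.2 tendsto_id
  refine le_antisymm ?_ (iSup_le fun e => ?_)
  · set A := ⨆ e : affineMinorants φ, ENNReal.ofReal e.1.1 with hA
    obtain ⟨t, -, ht⟩ := hφ.proper
    have hb : ∀ s : ℝ≥0, t ≤ s → φ s ≤ φ t + A * s := fun s hts => by
      rw [hφ.eq_iSup_affineMinorants s]
      refine iSup_le fun e => ?_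
      have h1 : e.1.1 * s + e.1.2 = (e.1.1 * t + e.1.2) + e.1.1 * ((s : ℝ) - t) := by ring
      rw [h1]
      have hst : (0 : ℝ) ≤ s - t := sub_nonneg.2 (by exact_mod_cast hts)
      refine ENNReal.ofReal_add_le.trans (add_le_add (e.2 t) ?_)
      rw [ENNReal.ofReal_mul' hst]
      refine mul_le_mul' (le_iSup (fun e : affineMinorants φ => ENNReal.ofReal e.1.1) e) ?_
      rw [← ENNReal.ofReal_coe_nnreal]
      exact ENNReal.ofReal_le_ofReal (by simp)
    have hlim : Tendsto (fun s : ℝ≥0 => φ t / (s : ℝ≥0∞) + A) atTop (𝓝 (0 + A)) := by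
      refine Tendsto.add ?_ tendsto_const_nhds
      have h := ENNReal.Tendsto.div (tendsto_const_nhds (x := φ t)) (Or.inr (by simp)) htop
        (Or.inr ht.ne)
      simpa using h
    rw [zero_add] at hlim
    rw [← hlim.limsup_eq, recession]
    refine limsup_le_limsup ?_
    filter_upwards [eventually_ge_atTop t, eventually_gt_atTop 0] with s hs hs0
    calc φ s / s ≤ (φ t + A * s) / s := ENNReal.div_le_div_right (hb s hs) _
      _ = φ t / s + A := by
        rw [ENNReal.add_div, ENNReal.mul_div_cancel_right (by simpa using hs0.ne') (by simp)]
  · have hlim : Tendsto (fun s : ℝ≥0 => ENNReal.ofReal (e.1.1 + e.1.2 / s)) atTop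
        (𝓝 (ENNReal.ofReal e.1.1)) := by
      refine ENNReal.tendsto_ofReal ?_
      have h : Tendsto (fun s : ℝ≥0 => e.1.2 / (s : ℝ)) atTop (𝓝 0) :=
        Tendsto.div_atTop tendsto_const_nhds (NNReal.tendsto_coe_atTop.2 tendsto_id)
      simpa using h.const_add e.1.1
    rw [← hlim.limsup_eq, recession]
    refine limsup_le_limsup ?_
    filter_upwards [eventually_gt_atTop 0] with s hs0
    have hs : (0 : ℝ) < s := by exact_mod_cast hs0
    rw [ENNReal.le_div_iff_mul_le (Or.inl (by simpa using hs0.ne')) (Or.inl (by simp)),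
      ← ENNReal.ofReal_coe_nnreal, ← ENNReal.ofReal_mul' hs.le, add_mul, div_mul_cancel₀ _ hs.ne']
    exact e.2 s

end AffineMinorants

/-! ### Continuous approximation of simple functions -/

section Approximation

open scoped Topology

variable {Y : Type*} [MetricSpace Y] [MeasurableSpace Y] [BorelSpace Y]

theorem exists_seq_continuous_tendsto_ae_indicator (μ : Measure Y) [IsFiniteMeasure μ] {s : Set Y}
    (hs : MeasurableSet s) :
    ∃ f : ℕ → Y → ℝ, (∀ k, Continuous (f k)) ∧ (∀ k y, 0 ≤ f k y ∧ f k y ≤ 1) ∧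
      ∀ᵐ y ∂μ, Tendsto (fun k => f k y) atTop (𝓝 (s.indicator 1 y)) := by
  have hL : MemLp (s.indicator (1 : Y → ℝ)) 1 μ :=
    memLp_indicator_const 1 hs (1 : ℝ) (Or.inr (measure_ne_top _ _))
  choose g hg hgL using fun k : ℕ => hL.exists_boundedContinuous_eLpNorm_sub_le
    ENNReal.one_ne_top (ε := ((k : ℝ≥0∞) + 1)⁻¹) (by simp)
  have hlim : Tendsto (fun k => eLpNorm (⇑(g k) - s.indicator (1 : Y → ℝ)) 1 μ) atTop (𝓝 0) := by
    refine tendsto_of_tendsto_of_tendsto_of_le_of_le tendsto_const_nhds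
      ((tendsto_add_atTop_iff_nat 1).2 ENNReal.tendsto_inv_nat_nhds_zero) (fun _ => zero_le)
      fun k => ?_
    rw [eLpNorm_sub_comm]
    simpa using hg k
  obtain ⟨ns, -, hns⟩ := (tendstoInMeasure_of_tendsto_eLpNorm one_ne_zero
    (fun k => (hgL k).1) hL.1 hlim).exists_seq_tendsto_ae
  -- Clamping to `[0, 1]` is continuous and fixes the values of an indicator, so the limit is
  -- unchanged.
  refine ⟨fun k y => max 0 (min 1 (g (ns k) y)), fun k => by fun_prop, fun k y =>
    ⟨le_max_left _ _, max_le zero_le_one (min_le_left _ _)⟩, ?_⟩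
  filter_upwards [hns] with y hy
  have h := (tendsto_const_nhds (x := (0 : ℝ))).max
    ((tendsto_const_nhds (x := (1 : ℝ))).min hy)
  convert h using 2
  by_cases hys : y ∈ s <;> simp [hys]

/-- Simple functions with values in a convex set are almost everywhere limits of uniformly bounded
continuous functions with values in this set. -/
theorem SimpleFunc.exists_seq_continuous_tendsto_ae {F : Type*} [NormedAddCommGroup F]
    [NormedSpace ℝ F] {E : Set F} (hE : Convex ℝ E) [Nonempty E] (μ : Measure Y)
    [IsFiniteMeasure μ] (p : SimpleFunc Y E) :
    ∃ (R : ℝ) (q : ℕ → Y → F), (∀ k, Continuous (q k)) ∧ (∀ k y, q k y ∈ E) ∧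
      (∀ k y, ‖q k y‖ ≤ R) ∧ ∀ᵐ y ∂μ, Tendsto (fun k => q k y) atTop (𝓝 (p y : F)) := by
  classical
  induction p using SimpleFunc.induction' with
  | const c =>
    exact ⟨‖(c : F)‖, fun _ _ => c, fun _ => continuous_const, fun _ _ => c.2, fun _ _ => le_rfl,
      Eventually.of_forall fun _ => tendsto_const_nhds⟩
  | @pcw p p' s hs hp hp' =>
    obtain ⟨R, q, hqc, hqE, hqR, hq⟩ := hp
    obtain ⟨R', q', hqc', hqE', hqR', hq'⟩ := hp'
    obtain ⟨f, hfc, hf01, hf⟩ := exists_seq_continuous_tendsto_ae_indicator μ hs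
    -- The indicator of `s` is replaced by weights in `[0, 1]`, so convexity keeps the values in
    -- `E`.
    refine ⟨max R R', fun k y => f k y • q k y + (1 - f k y) • q' k y, fun k => by fun_prop,
      fun k y => hE (hqE k y) (hqE' k y) (hf01 k y).1 (by linarith [(hf01 k y).2]) (by ring),
      fun k y => ?_, ?_⟩
    · have h1 : 0 ≤ 1 - f k y := by linarith [(hf01 k y).2]
      calc _ ≤ ‖f k y • q k y‖ + ‖(1 - f k y) • q' k y‖ := norm_add_le _ _
        _ ≤ f k y * max R R' + (1 - f k y) * max R R' := by
          rw [norm_smul, norm_smul, Real.norm_of_nonneg (hf01 k y).1, Real.norm_of_nonneg h1]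
          exact add_le_add
            (mul_le_mul_of_nonneg_left ((hqR k y).trans (le_max_left _ _)) (hf01 k y).1)
            (mul_le_mul_of_nonneg_left ((hqR' k y).trans (le_max_right _ _)) h1)
        _ = _ := by ring
    · filter_upwards [hf, hq, hq'] with y h1 h2 h3
      have h := (h1.smul h2).add ((h1.const_sub 1).smul h3)
      by_cases hys : y ∈ s <;> simpa [hys] using h

end Approximation

/-! ### Dual description of the divergence -/

section Divergence

open scoped Topology

variable {β : Type*} [MeasurableSpace β]

/-- The pairing of `(g, h) = q` with the pair of measures `(ν, ν₀)`. -/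
noncomputable def dualPairing (ν ν₀ : Measure β) (q : β → ℝ × ℝ) : ℝ :=
  ∫ y, (q y).1 ∂ν + ∫ y, (q y).2 ∂ν₀

open Classical in
/-- The integrand of `dualPairing` with respect to `ν₀ + ν.singularPart ν₀`. -/
noncomputable def pairingDensity (ν ν₀ : Measure β) (e : ℝ × ℝ) (y : β) : ℝ :=
  if y ∈ (ν.mutuallySingular_singularPart ν₀).nullSet then
    e.1 * (ν.rnDeriv ν₀ y).toNNReal + e.2 else e.1

variable (ν ν₀ : Measure β)

theorem ae_mem_nullSet_singularPart :
    ∀ᵐ y ∂ν₀, y ∈ (ν.mutuallySingular_singularPart ν₀).nullSet :=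
  measure_eq_zero_iff_ae_notMem.1 (ν.mutuallySingular_singularPart ν₀).measure_compl_nullSet |>.mono
    fun _ h => not_not.1 h

theorem ae_notMem_nullSet_singularPart :
    ∀ᵐ y ∂ν.singularPart ν₀, y ∉ (ν.mutuallySingular_singularPart ν₀).nullSet :=
  measure_eq_zero_iff_ae_notMem.1 (ν.mutuallySingular_singularPart ν₀).measure_nullSet

theorem measurable_pairingDensity {q : β → ℝ × ℝ} (hq : Measurable q) :
    Measurable fun y => pairingDensity ν ν₀ (q y) y := by
  classical
  unfold pairingDensity
  refine Measurable.ite (Measure.MutuallySingular.measurableSet_nullSet _) ?_ hq.fst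
  exact (hq.fst.mul (Measure.measurable_rnDeriv ν ν₀).ennreal_toNNReal.coe_nnreal_real).add hq.snd

/-- `ν₀` and the singular part live on disjoint sets, so one integrand serves both: there the
suprema of minorants and of slopes give `φ` of the density and the recession constant. -/
theorem phiDiv_eq_lintegral_iSup {φ : ℝ≥0 → ℝ≥0∞} (hφ : IsEntropyFunction φ) :
    phiDiv φ ν ν₀ = ∫⁻ y, ⨆ e : affineMinorants φ, ENNReal.ofReal (pairingDensity ν ν₀ e y)
      ∂(ν₀ + ν.singularPart ν₀) := by
  rw [lintegral_add_measure, phiDiv]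
  congr 1
  · refine lintegral_congr_ae ?_
    filter_upwards [ae_mem_nullSet_singularPart ν ν₀] with y hy
    simp only [pairingDensity, if_pos hy]
    exact hφ.eq_iSup_affineMinorants _
  · rw [← lintegral_const]
    refine lintegral_congr_ae ?_
    filter_upwards [ae_notMem_nullSet_singularPart ν ν₀] with y hy
    simp only [pairingDensity, if_neg hy]
    exact hφ.recession_eq_iSup

theorem ofReal_integral_le_lintegral_ofReal {f : β → ℝ} (hf : Integrable f ν) :
    ENNReal.ofReal (∫ y, f y ∂ν) ≤ ∫⁻ y, ENNReal.ofReal (f y) ∂ν := by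
  rw [integral_eq_lintegral_pos_part_sub_lintegral_neg_part hf]
  exact (ENNReal.ofReal_le_ofReal (sub_le_self _ ENNReal.toReal_nonneg)).trans
    ENNReal.ofReal_toReal_le

variable [IsFiniteMeasure ν] [IsFiniteMeasure ν₀]

theorem integral_pairingDensity {q : β → ℝ × ℝ} (hq : Measurable q) {R : ℝ}
    (hR : ∀ y, ‖q y‖ ≤ R) :
    Integrable (fun y => pairingDensity ν ν₀ (q y) y) (ν₀ + ν.singularPart ν₀) ∧
      ∫ y, pairingDensity ν ν₀ (q y) y ∂(ν₀ + ν.singularPart ν₀) = dualPairing ν ν₀ q := by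
  have h1 : ∀ (ρ : Measure β) [IsFiniteMeasure ρ], Integrable (fun y => (q y).1) ρ := fun ρ _ =>
    Integrable.of_bound hq.fst.aestronglyMeasurable R
      (Eventually.of_forall fun y => (norm_fst_le _).trans (hR y))
  have h2 : Integrable (fun y => (q y).2) ν₀ :=
    Integrable.of_bound hq.snd.aestronglyMeasurable R
      (Eventually.of_forall fun y => (norm_snd_le _).trans (hR y))
  have hd : Integrable (fun y => (q y).1) (ν₀.withDensity (ν.rnDeriv ν₀)) :=
    (h1 ν).mono_measure (Measure.withDensity_rnDeriv_le ν ν₀)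
  have hlt := Measure.rnDeriv_lt_top ν ν₀
  have hd' : Integrable (fun y => (ν.rnDeriv ν₀ y).toReal • (q y).1) ν₀ :=
    (integrable_withDensity_iff_integrable_smul' (Measure.measurable_rnDeriv ν ν₀) hlt).1 hd
  have e0 : (fun y => pairingDensity ν ν₀ (q y) y) =ᵐ[ν₀]
      fun y => (ν.rnDeriv ν₀ y).toReal • (q y).1 + (q y).2 := by
    filter_upwards [ae_mem_nullSet_singularPart ν ν₀] with y hy
    simp only [pairingDensity, if_pos hy, smul_eq_mul, mul_comm (q y).1]
    rfl
  have e1 : (fun y => pairingDensity ν ν₀ (q y) y) =ᵐ[ν.singularPart ν₀] fun y => (q y).1 := by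
    filter_upwards [ae_notMem_nullSet_singularPart ν ν₀] with y hy
    simp only [pairingDensity, if_neg hy]
  have i0 := (hd'.add h2).congr e0.symm
  have i1 := (h1 (ν.singularPart ν₀)).congr e1.symm
  refine ⟨integrable_add_measure.2 ⟨i0, i1⟩, ?_⟩
  rw [integral_add_measure i0 i1, integral_congr_ae e0, integral_congr_ae e1,
    integral_add hd' h2, ← integral_withDensity_eq_integral_toReal_smul
      (Measure.measurable_rnDeriv ν ν₀) hlt, dualPairing]
  have e2 : ∫ y, (q y).1 ∂ν = ∫ y, (q y).1 ∂(ν.singularPart ν₀)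
      + ∫ y, (q y).1 ∂(ν₀.withDensity (ν.rnDeriv ν₀)) := by
    rw [← integral_add_measure (h1 _) hd, ← Measure.haveLebesgueDecomposition_add]
  rw [e2]
  ring

theorem ofReal_dualPairing_le_phiDiv {φ : ℝ≥0 → ℝ≥0∞} (hφ : IsEntropyFunction φ)
    {q : β → ℝ × ℝ} (hq : Measurable q) {R : ℝ} (hR : ∀ y, ‖q y‖ ≤ R)
    (hqE : ∀ y, q y ∈ affineMinorants φ) :
    ENNReal.ofReal (dualPairing ν ν₀ q) ≤ phiDiv φ ν ν₀ := by
  rw [phiDiv_eq_lintegral_iSup ν ν₀ hφ, ← (integral_pairingDensity ν ν₀ hq hR).2]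
  refine (ofReal_integral_le_lintegral_ofReal _
    (integral_pairingDensity ν ν₀ hq hR).1).trans (lintegral_mono fun y => ?_)
  exact le_iSup (fun e : affineMinorants φ => ENNReal.ofReal (pairingDensity ν ν₀ e y))
    ⟨q y, hqE y⟩

/-- The divergence is the supremum of the pairings with simple functions of affine minorants. -/
theorem exists_simpleFunc_lt_dualPairing {φ : ℝ≥0 → ℝ≥0∞} (hφ : IsEntropyFunction φ) {c : ℝ≥0∞}
    (hc : c < phiDiv φ ν ν₀) :
    ∃ p : SimpleFunc β (affineMinorants φ),
      c < ENNReal.ofReal (dualPairing ν ν₀ fun y => (p y : ℝ × ℝ)) := by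
  classical
  set E := affineMinorants φ with hE
  have : Nonempty E := ⟨⟨0, zero_mem_affineMinorants φ⟩⟩
  set v : E → β → ℝ := fun e y => pairingDensity ν ν₀ e y with hv
  set d := TopologicalSpace.denseSeq E with hd
  have hvm : ∀ p : SimpleFunc β E, Measurable fun y => v (p y) y := fun p =>
    measurable_pairingDensity ν ν₀ (q := fun y => (p y : ℝ × ℝ))
      (measurable_subtype_coe.comp p.measurable)
  have hvc : ∀ y, Continuous fun e : E => ENNReal.ofReal (v e y) := fun y => by
    refine ENNReal.continuous_ofReal.comp ?_
    simp only [hv, pairingDensity]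
    split_ifs <;> fun_prop
  have hset : ∀ (p : SimpleFunc β E) (e : E), MeasurableSet {y | v (p y) y < v e y} := fun p e =>
    measurableSet_lt (hvm p) (hvm (SimpleFunc.const β e))
  -- Greedy selection: at each point keep the best of the zero minorant and the first `n` members of
  -- a dense sequence. The values are nonnegative and increase to the supremum, so monotone
  -- convergence applies.
  let p : ℕ → SimpleFunc β E := fun n => Nat.rec (SimpleFunc.const β ⟨0, zero_mem_affineMinorants φ⟩)
    (fun n r => SimpleFunc.piecewise {y | v (r y) y < v (d n) y} (hset r (d n))
      (SimpleFunc.const β (d n)) r) n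
  have hstep : ∀ n y, v (p (n + 1) y) y = max (v (p n y) y) (v (d n) y) := fun n y => by
    have h : p (n + 1) y = if v (p n y) y < v (d n) y then d n else p n y := rfl
    rw [h]
    split_ifs with h'
    · exact (max_eq_right h'.le).symm
    · exact (max_eq_left (not_lt.1 h')).symm
  have hmono : ∀ y, Monotone fun n => v (p n y) y := fun y =>
    monotone_nat_of_le_succ fun n => (le_max_left _ _).trans_eq (hstep n y).symm
  have hnn : ∀ n y, 0 ≤ v (p n y) y := fun n y => by
    refine le_trans (le_of_eq ?_) (hmono y (Nat.zero_le n))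
    simp [p, hv, pairingDensity]
  have hsup : ∀ y, ⨆ e : E, ENNReal.ofReal (v e y) = ⨆ n, ENNReal.ofReal (v (p n y) y) := fun y => by
    refine le_antisymm (iSup_le fun e => le_of_forall_lt fun a ha => ?_)
      (iSup_le fun n => le_iSup (fun e : E => ENNReal.ofReal (v e y)) (p n y))
    obtain ⟨n, hn⟩ := (TopologicalSpace.denseRange_denseSeq E).exists_mem_open
      (isOpen_lt continuous_const (hvc y)) ⟨e, ha⟩
    refine lt_of_lt_of_le hn (le_trans (ENNReal.ofReal_le_ofReal ?_)
      (le_iSup (fun n => ENNReal.ofReal (v (p n y) y)) (n + 1)))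
    rw [hstep]
    exact le_max_right _ _
  rw [phiDiv_eq_lintegral_iSup ν ν₀ hφ] at hc
  change c < ∫⁻ y, ⨆ e : E, ENNReal.ofReal (v e y) ∂_ at hc
  simp only [hsup] at hc
  rw [lintegral_iSup (fun n => (hvm (p n)).ennreal_ofReal)
    fun m n hmn y => ENNReal.ofReal_le_ofReal (hmono y hmn)] at hc
  obtain ⟨n, hn⟩ := lt_iSup_iff.1 hc
  obtain ⟨R, hR⟩ := ((p n).map (Subtype.val : E → ℝ × ℝ)).exists_forall_norm_le
  obtain ⟨hi, he⟩ := integral_pairingDensity ν ν₀ (q := fun y => (p n y : ℝ × ℝ))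
    (measurable_subtype_coe.comp (p n).measurable) hR
  refine ⟨p n, ?_⟩
  rwa [← he, ofReal_integral_eq_lintegral_ofReal hi (Eventually.of_forall (hnn n))]

end Divergence

/-! ### Weak lower semicontinuity of the divergence -/

section LowerSemicontinuity

open scoped Topology BoundedContinuousFunction

variable {Y : Type*} [MetricSpace Y] [MeasurableSpace Y] [BorelSpace Y]

theorem phiDiv_eq_iSup_dualPairing {φ : ℝ≥0 → ℝ≥0∞} (hφ : IsEntropyFunction φ)
    (ν ν₀ : Measure Y) [IsFiniteMeasure ν] [IsFiniteMeasure ν₀] :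
    phiDiv φ ν ν₀ = ⨆ q : {q : Y →ᵇ ℝ × ℝ // ∀ y, q y ∈ affineMinorants φ},
      ENNReal.ofReal (dualPairing ν ν₀ q.1) := by
  refine le_antisymm (le_of_forall_lt fun c hc => ?_) (iSup_le fun q =>
    ofReal_dualPairing_le_phiDiv ν ν₀ hφ q.1.continuous.measurable q.1.norm_coe_le_norm q.2)
  obtain ⟨p, hp⟩ := exists_simpleFunc_lt_dualPairing ν ν₀ hφ hc
  have : Nonempty (affineMinorants φ) := ⟨⟨0, zero_mem_affineMinorants φ⟩⟩
  -- Convergence almost everywhere for `ν + ν₀` serves both integrals of the pairing under dominated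
  -- convergence.
  obtain ⟨R, q, hqc, hqE, hqR, hq⟩ := SimpleFunc.exists_seq_continuous_tendsto_ae
    (convex_affineMinorants φ) (ν + ν₀) p
  rw [ae_add_measure_iff] at hq
  have hlim : Tendsto (fun k => dualPairing ν ν₀ (q k)) atTop
      (𝓝 (dualPairing ν ν₀ fun y => (p y : ℝ × ℝ))) := by
    refine Tendsto.add ?_ ?_
    · exact tendsto_integral_of_dominated_convergence (fun _ => R)
        (fun k => (continuous_fst.comp (hqc k)).measurable.aestronglyMeasurable)
        (integrable_const R)
        (fun k => Eventually.of_forall fun y => (norm_fst_le _).trans (hqR k y))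
        (hq.1.mono fun y hy => (continuous_fst.tendsto _).comp hy)
    · exact tendsto_integral_of_dominated_convergence (fun _ => R)
        (fun k => (continuous_snd.comp (hqc k)).measurable.aestronglyMeasurable)
        (integrable_const R)
        (fun k => Eventually.of_forall fun y => (norm_snd_le _).trans (hqR k y))
        (hq.2.mono fun y hy => (continuous_snd.tendsto _).comp hy)
  obtain ⟨k, hk⟩ := ((ENNReal.tendsto_ofReal hlim).eventually (lt_mem_nhds hp)).exists
  exact hk.trans_le (le_iSup (fun q : {q : Y →ᵇ ℝ × ℝ // ∀ y, q y ∈ affineMinorants φ} =>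
    ENNReal.ofReal (dualPairing ν ν₀ q.1))
    ⟨BoundedContinuousFunction.ofNormedAddCommGroup (q k) (hqc k) R (hqR k), hqE k⟩)

/-- The `φ`-divergence is weakly lower semicontinuous in its first argument. -/
theorem lowerSemicontinuous_phiDiv {φ : ℝ≥0 → ℝ≥0∞} (hφ : IsEntropyFunction φ)
    (ν₀ : ProbabilityMeasure Y) :
    LowerSemicontinuous fun ν : ProbabilityMeasure Y => phiDiv φ (ν : Measure Y) ν₀ := by
  simp only [phiDiv_eq_iSup_dualPairing hφ]
  refine lowerSemicontinuous_iSup fun q => Continuous.lowerSemicontinuous ?_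
  refine ENNReal.continuous_ofReal.comp (Continuous.add ?_ continuous_const)
  exact ProbabilityMeasure.continuous_integral_boundedContinuousFunction
    (BoundedContinuousFunction.ofNormedAddCommGroup (fun y => (q.1 y).1)
      (continuous_fst.comp q.1.continuous) ‖q.1‖
      fun y => (norm_fst_le _).trans (q.1.norm_coe_le_norm y))

end LowerSemicontinuity

/-! ### Existence for the abstract max-min problem -/

section Optimizer

open scoped Topology

variable {X Y : Type*} [MetricSpace X] [SecondCountableTopology X] [MeasurableSpace X]
  [BorelSpace X] [MetricSpace Y] [CompleteSpace Y] [SecondCountableTopology Y] [MeasurableSpace Y]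
  [BorelSpace Y]

/-- The second marginal of a joint law. -/
noncomputable def secondMarginal {X Y : Type*} [MeasurableSpace X] [MeasurableSpace Y]
    (γ : ProbabilityMeasure (X × Y)) : ProbabilityMeasure Y :=
  γ.map measurable_snd.aemeasurable

theorem coe_secondMarginal {X Y : Type*} [MeasurableSpace X] [MeasurableSpace Y]
    (γ : ProbabilityMeasure (X × Y)) :
    (secondMarginal γ : Measure Y) = (γ : Measure (X × Y)).snd := rfl

theorem secondMarginal_congr {X Y : Type*} [MeasurableSpace X] [MeasurableSpace Y]
    {γ γ' : ProbabilityMeasure (X × Y)}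
    (h : (γ : Measure (X × Y)).snd = (γ' : Measure (X × Y)).snd) :
    secondMarginal γ = secondMarginal γ' := Subtype.ext h

theorem continuous_secondMarginal {X Y : Type*} [TopologicalSpace X] [MeasurableSpace X]
    [TopologicalSpace Y] [MeasurableSpace Y] [OpensMeasurableSpace (X × Y)] [BorelSpace Y] :
    Continuous (secondMarginal : ProbabilityMeasure (X × Y) → ProbabilityMeasure Y) :=
  ProbabilityMeasure.continuous_map continuous_snd

theorem nonempty_jointLaws_secondMarginal {X Y : Type*} [MeasurableSpace X] [MeasurableSpace Y]
    (μ : ProbabilityMeasure X) (ν : ProbabilityMeasure Y) :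
    ∃ γ ∈ jointLaws Y μ, secondMarginal γ = ν :=
  ⟨μ.prod ν, by simp [jointLaws], Subtype.ext (by simp [coe_secondMarginal])⟩

theorem continuous_distObjective {X Y : Type*} [TopologicalSpace X] [MeasurableSpace X]
    [TopologicalSpace Y] [MeasurableSpace Y] [OpensMeasurableSpace (X × Y)] {U : X → Y → ℝ} (hU : Continuous (Function.uncurry U)) {C : ℝ}
    (hC : ∀ x y, |U x y| ≤ C) :
    Continuous (distObjective U : ProbabilityMeasure (X × Y) → EReal) :=
  continuous_coe_real_ereal.comp (ProbabilityMeasure.continuous_integral_boundedContinuousFunction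
    (BoundedContinuousFunction.ofNormedAddCommGroup (Function.uncurry U) hU C fun p => hC p.1 p.2))

theorem distObjective_add_coe_ne_bot {X Y : Type*} [MeasurableSpace X] [MeasurableSpace Y]
    (U : X → Y → ℝ) (γ : ProbabilityMeasure (X × Y)) (a : ℝ≥0∞) :
    distObjective U γ + (a : EReal) ≠ ⊥ :=
  EReal.add_ne_bot_iff.2 ⟨EReal.coe_ne_bot _, EReal.coe_ennreal_ne_bot _⟩

theorem lowerSemicontinuous_distObjective_add {X Y : Type*} [TopologicalSpace X]
    [MeasurableSpace X] [TopologicalSpace Y] [MeasurableSpace Y] [OpensMeasurableSpace (X × Y)]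
    [BorelSpace Y] {U : X → Y → ℝ}
    (hU : Continuous (Function.uncurry U)) {C : ℝ} (hC : ∀ x y, |U x y| ≤ C)
    {Φ : ProbabilityMeasure Y → ℝ≥0∞} (hΦ : LowerSemicontinuous Φ) :
    LowerSemicontinuous fun γ : ProbabilityMeasure (X × Y) =>
      distObjective U γ + (Φ (secondMarginal γ) : EReal) := by
  refine (continuous_distObjective hU hC).lowerSemicontinuous.add'
    (continuous_coe_ennreal_ereal.comp_lowerSemicontinuous
      (hΦ.comp continuous_secondMarginal) EReal.coe_ennreal_strictMono.monotone)
    fun γ => EReal.continuousAt_add (Or.inl (EReal.coe_ne_top _)) (Or.inl (EReal.coe_ne_bot _))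

/-- Max-min problems over joint laws with prescribed first marginal, whose second marginal is
constrained to a closed set and penalized by a lower semicontinuous function, have optimizers. -/
theorem exists_isMaxMinOptimizer_jointLaws {U : X → Y → ℝ} (hU : Continuous (Function.uncurry U))
    {C : ℝ} (hC₀ : 0 ≤ C) (hC : ∀ x y, |U x y| ≤ C) {S : Set (ProbabilityMeasure X)}
    (hS_ne : S.Nonempty) (hS : IsSeqCompact S) (hΓ : ∀ μ ∈ S, IsCompact (jointLaws Y μ))
    {N : Set (ProbabilityMeasure Y)} (hN : IsClosed N) (hN_ne : N.Nonempty)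
    {Φ : ProbabilityMeasure Y → ℝ≥0∞} (hΦ : LowerSemicontinuous Φ) :
    ∃ μ γ, IsMaxMinOptimizer S (fun μ => jointLaws Y μ ∩ secondMarginal ⁻¹' N)
      (fun _ γ => distObjective U γ + (Φ (secondMarginal γ) : EReal)) μ γ := by
  set T : ProbabilityMeasure X → Set (ProbabilityMeasure (X × Y)) :=
    fun μ => jointLaws Y μ ∩ secondMarginal ⁻¹' N with hT
  set f : ProbabilityMeasure (X × Y) → EReal :=
    fun γ => distObjective U γ + (Φ (secondMarginal γ) : EReal) with hf
  set G : ProbabilityMeasure X → EReal := fun μ => ⨅ γ ∈ T μ, f γ with hG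
  have hlsc : LowerSemicontinuous f := lowerSemicontinuous_distObjective_add hU hC hΦ
  have hin : ∀ μ ∈ S, ∃ γ ∈ T μ, f γ = G μ := fun μ hμ => by
    obtain ⟨ν, hν⟩ := hN_ne
    obtain ⟨γ, hγ, hγν⟩ := nonempty_jointLaws_secondMarginal μ ν
    obtain ⟨γ', hγ', hmin⟩ := LowerSemicontinuousOn.exists_isMinOn
      (⟨γ, hγ, by rwa [mem_preimage, hγν]⟩ : (T μ).Nonempty)
      ((hΓ μ hμ).inter_right (hN.preimage continuous_secondMarginal))
      (hlsc.lowerSemicontinuousOn _)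
    exact ⟨γ', hγ', le_antisymm (le_iInf₂ fun b hb => hmin hb) (iInf₂_le γ' hγ')⟩
  obtain ⟨u, -, hu, huS⟩ := exists_seq_tendsto_sSup (hS_ne.image G) (OrderTop.bddAbove _)
  rw [sSup_image] at hu
  choose μs hμsS hμsG using huS
  obtain ⟨μ, hμ, ψ, hψ, hlim⟩ := hS hμsS
  obtain ⟨γ, hγ, hγG⟩ := hin μ hμ
  refine ⟨μ, γ, hμ, hγ, hγG, le_antisymm (le_iSup₂ (f := fun μ _ => G μ) μ hμ) ?_⟩
  change ⨆ a ∈ S, G a ≤ G μ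
  -- The moved law `γ'` has the second marginal of `γ`, hence stays in `N` with the same penalty,
  -- and bounds `G` along the maximizing sequence.
  have hstep : ∀ ε : ℝ, 0 < ε → ⨆ a ∈ S, G a ≤ f γ + (ε : EReal) := fun ε hε => by
    refine le_of_tendsto (hu.comp hψ.tendsto_atTop) ?_
    filter_upwards [eventually_exists_jointLaw_integral_le U hU hC₀ hC hlim hγ.1 hε]
      with k ⟨γ', h₁, h₂, h₃⟩
    have hm : secondMarginal γ' = secondMarginal γ := secondMarginal_congr h₂
    rw [Function.comp_apply, ← hμsG]
    refine (iInf₂_le γ' ⟨h₁, by rw [mem_preimage, hm]; exact hγ.2⟩).trans ?_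
    simp only [hf]
    rw [hm, add_right_comm]
    refine add_le_add ?_ le_rfl
    rw [distObjective, distObjective, ← EReal.coe_add]
    exact EReal.coe_le_coe_iff.2 h₃
  rw [← hγG]
  -- The value `f γ` may be `⊤`. Comparing with some `c > f γ` makes it real, so `ε` can be taken as
  -- a difference of reals.
  refine le_of_forall_gt fun c hc => ?_
  obtain ⟨z, hz, hzc⟩ := EReal.lt_iff_exists_real_btwn.1 hc
  have hr : ((f γ).toReal : EReal) = f γ :=
    EReal.coe_toReal (hz.trans (EReal.coe_lt_top z)).ne (distObjective_add_coe_ne_bot U γ _)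
  rw [← hr, EReal.coe_lt_coe_iff] at hz
  refine lt_of_le_of_lt (hstep (z - (f γ).toReal) (sub_pos.2 hz)) ?_
  rw [← hr, ← EReal.coe_add, EReal.toReal_coe, add_sub_cancel]
  exact hzc

end Optimizer

/-! ### Nonemptiness of the ambiguity set -/

section Feasibility

open scoped Topology

variable {X Y : Type*} [TopologicalSpace X] [MeasurableSpace X] [MetricSpace Y] [MeasurableSpace Y]
  [BorelSpace Y] [OpensMeasurableSpace (X × Y)]

/-- A subgradient of the penalized value dominates the minimal divergence. -/
theorem divBall_nonempty_of_mem_concaveSubdifferential {φ : ℝ≥0 → ℝ≥0∞} (hφ : IsEntropyFunction φ)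
    (ν₀ : ProbabilityMeasure Y) {U : X → Y → ℝ} (hU : Continuous (Function.uncurry U)) {C : ℝ}
    (hC : ∀ x y, |U x y| ≤ C) {M : Set (ProbabilityMeasure X)} {μ : ProbabilityMeasure X}
    (hμ : μ ∈ M) (hΓ : IsCompact (jointLaws Y μ)) {θ η : ℝ}
    (hη : η ∈ concaveSubdifferential (Ici 0) (Jpd φ ν₀ U M) θ) :
    (divBall φ ν₀ η).Nonempty := by
  obtain ⟨r, -, hr⟩ := hη
  obtain ⟨γ₀, hγ₀, -⟩ := nonempty_jointLaws_secondMarginal μ ν₀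
  obtain ⟨γ, hγ, hmin⟩ := LowerSemicontinuousOn.exists_isMinOn ⟨γ₀, hγ₀⟩ hΓ
    (((lowerSemicontinuous_phiDiv hφ ν₀).comp
      (continuous_secondMarginal (X := X))).lowerSemicontinuousOn _)
  set d := phiDiv φ (secondMarginal γ : Measure Y) ν₀ with hd
  refine ⟨secondMarginal γ, ?_⟩
  change (d : EReal) ≤ η
  have hlow : ∀ θ' : ℝ, 0 ≤ θ' → ((-C : ℝ) : EReal) + ((ENNReal.ofReal θ' * d : ℝ≥0∞) : EReal)
      ≤ ((r + η * (θ' - θ) : ℝ) : EReal) := fun θ' hθ' => by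
    refine le_trans ?_ (hr θ' hθ')
    refine le_trans ?_ (le_iSup₂ (f := fun μ _ => ⨅ γ ∈ jointLaws Y μ, penObjective φ ν₀ U θ' γ)
      μ hμ)
    refine le_iInf₂ fun γ' hγ' => add_le_add (EReal.coe_le_coe_iff.2 ?_)
      (EReal.coe_ennreal_le_coe_ennreal_iff.2 (mul_le_mul_right (hmin hγ') _))
    have h := integral_mono (μ := (γ' : Measure (X × Y))) (integrable_const (-C))
      (integrable_of_continuous_of_abs_le hU (fun p => hC p.1 p.2) _)
      fun p => (abs_le.1 (hC p.1 p.2)).1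
    simp only [integral_const, probReal_univ, one_smul] at h
    exact h
  have hd_top : d ≠ ∞ := fun h => by
    have := hlow 1 zero_le_one
    rw [h, ENNReal.ofReal_one, one_mul, EReal.coe_ennreal_top, EReal.coe_add_top] at this
    exact absurd this (not_le.2 (EReal.coe_lt_top _))
  rw [← EReal.coe_ennreal_toReal hd_top, EReal.coe_le_coe_iff]
  by_contra! hlt
  have hpos : 0 < d.toReal - η := sub_pos.2 hlt
  -- If `d > η`, the line `-C + θ' d` eventually exceeds `r + η (θ' - θ)`; this `θ'` is past the
  -- crossing.
  set θ' := (|r - η * θ + C| + 1) / (d.toReal - η) with hθ'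
  have hθ'₀ : 0 ≤ θ' := by positivity
  have h := hlow θ' hθ'₀
  rw [← EReal.coe_ennreal_toReal (ENNReal.mul_ne_top ENNReal.ofReal_ne_top hd_top),
    ENNReal.toReal_mul, ENNReal.toReal_ofReal hθ'₀, ← EReal.coe_add, EReal.coe_le_coe_iff] at h
  have h2 : θ' * (d.toReal - η) = |r - η * θ + C| + 1 := div_mul_cancel₀ _ hpos.ne'
  have h3 := le_abs_self (r - η * θ + C)
  nlinarith

end Feasibility

/-! ### Realizing joint laws by random variables -/

section Randomization

open ProbabilityTheory unitInterval

variable {Ω α β : Type*} [MeasurableSpace α] [MeasurableSpace β] [StandardBorelSpace β] [Nonempty β]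

/-- Given a uniform variable independent of `X`, every joint law with first marginal the law of `X`
is the law of a pair `(X, Y)`. -/
theorem exists_measurable_map_prodMk_eq (𝓕 𝓕' : MeasurableSpace Ω) [mΩ : MeasurableSpace Ω]
    (h𝓕 : 𝓕 ≤ mΩ) (h𝓕' : 𝓕' ≤ mΩ) (P : Measure Ω) [IsProbabilityMeasure P]
    (h_indep : Indep 𝓕 𝓕' P) {V : Ω → ℝ} (hV : Measurable[𝓕'] V)
    (hVP : P.map V = volume.restrict (Set.Icc 0 1)) {X : Ω → α} (hX : Measurable[𝓕] X)
    (γ : Measure (α × β)) [IsProbabilityMeasure γ] (hγ : γ.fst = P.map X) :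
    ∃ Y : Ω → β, Measurable[𝓕 ⊔ 𝓕'] Y ∧ P.map (fun ω => (X ω, Y ω)) = γ := by
  -- The conditional law of the second coordinate given `x` is the image of Lebesgue measure under
  -- `f x`, so `Y = f X W` with `W` uniform and independent of `X`.
  obtain ⟨f, hf, hfκ⟩ := Kernel.exists_measurable_map_eq_unitInterval γ.condKernel
  -- `V` lies in `[0, 1]` only almost surely; projecting gives an honest `I`-valued variable with
  -- uniform law.
  set W : Ω → I := fun ω => Set.projIcc (0 : ℝ) 1 zero_le_one (V ω) with hW
  have hWm : Measurable[𝓕'] W := continuous_projIcc.measurable.comp hV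
  have hX' : Measurable X := hX.mono h𝓕 le_rfl
  have hV' : Measurable V := hV.mono h𝓕' le_rfl
  have hW' : Measurable W := hWm.mono h𝓕' le_rfl
  have hWP : P.map W = volume := by
    have h1 : P.map W = (P.map V).map (Set.projIcc (0 : ℝ) 1 zero_le_one) :=
      (Measure.map_map continuous_projIcc.measurable hV').symm
    rw [h1, hVP, ← map_comap_subtype_coe measurableSet_Icc, ← Measure.Subtype.volume_def,
      Measure.map_map continuous_projIcc.measurable measurable_subtype_coe]
    have h2 : Set.projIcc (0 : ℝ) 1 zero_le_one ∘ ((↑) : Set.Icc (0 : ℝ) 1 → ℝ) = id :=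
      funext fun x => Set.projIcc_val zero_le_one x
    rw [h2, Measure.map_id]
  have hind : IndepFun X W P := by
    rw [IndepFun_iff_Indep]
    exact indep_of_indep_of_le_left (indep_of_indep_of_le_right h_indep hWm.comap_le) hX.comap_le
  have hjoint := (indepFun_iff_map_prod_eq_prod_map_map hX'.aemeasurable hW'.aemeasurable).1 hind
  refine ⟨fun ω => f (X ω) (W ω), ?_, ?_⟩
  · have hX₁ : Measurable[𝓕 ⊔ 𝓕'] X := hX.mono (le_sup_left : 𝓕 ≤ 𝓕 ⊔ 𝓕') le_rfl
    have hW₁ : Measurable[𝓕 ⊔ 𝓕'] W := hWm.mono (le_sup_right : 𝓕' ≤ 𝓕 ⊔ 𝓕') le_rfl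
    exact @Measurable.comp _ _ _ (𝓕 ⊔ 𝓕') _ _ _ _ hf (hX₁.prodMk hW₁)
  · have hfp : Measurable fun p : α × I => (p.1, f p.1 p.2) := measurable_fst.prodMk hf
    have h1 : P.map (fun ω => (X ω, f (X ω) (W ω)))
        = (P.map fun ω => (X ω, W ω)).map fun p : α × I => (p.1, f p.1 p.2) :=
      (Measure.map_map hfp (hX'.prodMk hW')).symm
    have : IsProbabilityMeasure (P.map X) := Measure.isProbabilityMeasure_map hX'.aemeasurable
    rw [h1, hjoint, hWP, ← γ.disintegrate γ.condKernel, hγ]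
    ext s hs
    rw [Measure.map_apply hfp hs, Measure.prod_apply (hfp hs), Measure.compProd_apply hs]
    refine lintegral_congr fun a => ?_
    have hfa : Measurable (f a) := hf.comp measurable_prodMk_left
    rw [← hfκ a, Measure.map_apply hfa (measurable_prodMk_left hs)]
    rfl

/-- The inner problems over environment variables and over joint laws have the same value. -/
theorem iInf_environments_eq (𝓕 𝓕' : MeasurableSpace Ω) [mΩ : MeasurableSpace Ω]
    (h𝓕 : 𝓕 ≤ mΩ) (h𝓕' : 𝓕' ≤ mΩ) (P : Measure Ω) [IsProbabilityMeasure P]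
    (h_indep : Indep 𝓕 𝓕' P) {V : Ω → ℝ} (hV : Measurable[𝓕'] V)
    (hVP : P.map V = volume.restrict (Set.Icc 0 1)) {X : Ω → α} (hX : Measurable[𝓕] X)
    {μ : ProbabilityMeasure α} (hμ : (μ : Measure α) = P.map X) (φ : ℝ≥0 → ℝ≥0∞)
    (ν₀ : ProbabilityMeasure β) (η : ℝ) {U : α → β → ℝ} (hU : Measurable (Function.uncurry U)) :
    ⨅ Y ∈ environments (𝓕 ⊔ 𝓕') P φ ν₀ η, ((∫ ω, U (X ω) (Y ω) ∂P : ℝ) : EReal)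
      = ⨅ γ ∈ constrainedJointLaws φ ν₀ η μ, distObjective U γ := by
  have hX' : Measurable X := hX.mono h𝓕 le_rfl
  have hint : ∀ Y : Ω → β, Measurable Y →
      ∫ p, U p.1 p.2 ∂(P.map fun ω => (X ω, Y ω)) = ∫ ω, U (X ω) (Y ω) ∂P := fun Y hY =>
    integral_map (hX'.prodMk hY).aemeasurable hU.aestronglyMeasurable
  refine le_antisymm (le_iInf₂ fun γ hγ => ?_) (le_iInf₂ fun Y hY => ?_)
  · obtain ⟨ν, hν, h₁, h₂⟩ := hγ
    obtain ⟨Y, hY, hYγ⟩ := exists_measurable_map_prodMk_eq 𝓕 𝓕' h𝓕 h𝓕' P h_indep hV hVP hX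
      (γ : Measure (α × β)) (h₁.trans hμ)
    have hY' : Measurable Y := hY.mono (sup_le h𝓕 h𝓕') le_rfl
    refine (iInf₂_le Y ⟨hY, ν, hν, ?_⟩).trans_eq ?_
    · rw [← hint Y hY', hYγ]
      rfl
    · rw [← h₂, ← hYγ, Measure.snd_map_prodMk hX']
  · obtain ⟨hYm, ν, hν, hνY⟩ := hY
    have hY' : Measurable Y := hYm.mono (sup_le h𝓕 h𝓕') le_rfl
    refine (iInf₂_le (⟨P.map fun ω => (X ω, Y ω),
      Measure.isProbabilityMeasure_map (hX'.prodMk hY').aemeasurable⟩ : ProbabilityMeasure (α × β))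
      ⟨ν, hν, ?_, ?_⟩).trans_eq ?_
    · rw [← hint Y hY']
      rfl
    · exact (Measure.fst_map_prodMk hY').trans hμ.symm
    · exact (Measure.snd_map_prodMk hX').trans hνY.symm

end Randomization

/-! ### Assembly of the theorem -/

theorem constrainedJointLaws_eq {α β : Type*} [MeasurableSpace α] [MeasurableSpace β]
    (φ : ℝ≥0 → ℝ≥0∞) (ν₀ : ProbabilityMeasure β) (η : ℝ) (μ : ProbabilityMeasure α) :
    constrainedJointLaws φ ν₀ η μ = jointLaws β μ ∩ secondMarginal ⁻¹' divBall φ ν₀ η := by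
  ext γ
  constructor
  · rintro ⟨ν, hν, h₁, h₂⟩
    have h : secondMarginal γ = ν := Subtype.ext h₂
    exact ⟨h₁, by rwa [mem_preimage, h]⟩
  · rintro ⟨h₁, h₂⟩
    exact ⟨_, h₂, h₁, rfl⟩

theorem isClosed_divBall {β : Type*} [MetricSpace β] [MeasurableSpace β] [BorelSpace β]
    {φ : ℝ≥0 → ℝ≥0∞} (hφ : IsEntropyFunction φ) (ν₀ : ProbabilityMeasure β) (η : ℝ) :
    IsClosed (divBall φ ν₀ η) :=
  (continuous_coe_ennreal_ereal.comp_lowerSemicontinuous (lowerSemicontinuous_phiDiv hφ ν₀)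
    EReal.coe_ennreal_strictMono.monotone).isClosed_preimage _

theorem mainTheorem3 {n m : ℕ}
    (𝒳 : Set (EuclideanSpace ℝ (Fin n))) (𝒴 : Set (EuclideanSpace ℝ (Fin m)))
    (h𝒳_closed : IsClosed 𝒳) (h𝒳_convex : Convex ℝ 𝒳)
    (h𝒴_closed : IsClosed 𝒴) (h𝒴_convex : Convex ℝ 𝒴)
    -- the probability space; `𝓕` carries the decisions, `𝓕'` the additional randomness
    {Ω : Type*} (𝓕 𝓕' : MeasurableSpace Ω) [mΩ : MeasurableSpace Ω]
    (h𝓕 : 𝓕 ≤ mΩ) (h𝓕' : 𝓕' ≤ mΩ) (P : Measure Ω) [IsProbabilityMeasure P]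
    (h_indep : ProbabilityTheory.Indep 𝓕 𝓕' P)
    (h_rich : ∃ V : Ω → ℝ, Measurable[𝓕'] V ∧ P.map V = volume.restrict (Set.Icc 0 1))
    -- entropy function and nominal distribution
    (φ : ℝ≥0 → ℝ≥0∞) (hφ : IsEntropyFunction φ) (ν₀ : ProbabilityMeasure 𝒴)
    -- utility function: continuous, bounded, concave in the decision
    (U : 𝒳 → 𝒴 → ℝ) (hU_cont : Continuous (Function.uncurry U))
    (hU_bdd : ∃ C : ℝ, ∀ x y, |U x y| ≤ C) (hU_concave : ConcaveInDecision U)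
    -- decision set: nonempty, convex, with weakly compact set of distributions
    (𝒜 : Set (Ω → 𝒳)) (h𝒜_meas : ∀ X ∈ 𝒜, Measurable[𝓕] X) (h𝒜_nonempty : 𝒜.Nonempty)
    (h𝒜_convex : Convex ℝ
      ((fun (X : Ω → 𝒳) (ω : Ω) => (X ω : EuclideanSpace ℝ (Fin n))) '' 𝒜))
    (h𝒜_compact : IsSeqCompact (decisionLaws P 𝒜))
    -- coercivity
    (h_coercive : recession φ = ∞ ∨ ∀ a : ℝ, IsCompact {p : 𝒳 × 𝒴 | U p.1 p.2 ≤ a})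
    -- compactness of the sets of joint distributions
    (h_compact : MetricallyCompactJointLaws 𝒴 (decisionLaws P 𝒜)) :
    (∀ θ : ℝ, 0 ≤ θ → ∃ μ γ, IsJpdOptimizer φ ν₀ U (decisionLaws P 𝒜) θ μ γ) ∧
    (∀ η ∈ ⋃ θ ∈ Set.Ioi (0 : ℝ),
        concaveSubdifferential (Set.Ici 0) (Jpd φ ν₀ U (decisionLaws P 𝒜)) θ,
      ∃ μ γ, IsJcdOptimizer φ ν₀ U (decisionLaws P 𝒜) η μ γ ∧
        ∃ X Y, IsJcOptimizer (𝓕 ⊔ 𝓕') P φ ν₀ U 𝒜 η X Y ∧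
          P.map (fun ω => (X ω, Y ω)) = (γ : Measure (𝒳 × 𝒴))) := by
  have : CompleteSpace 𝒴 := h𝒴_closed.completeSpace_coe
  have : PolishSpace 𝒴 := h𝒴_closed.polishSpace
  have : Nonempty 𝒴 := nonempty_of_isProbabilityMeasure (ν₀ : Measure 𝒴)
  obtain ⟨C, hC⟩ := hU_bdd
  replace hC : ∀ x y, |U x y| ≤ |C| := fun x y => (hC x y).trans (le_abs_self C)
  obtain ⟨V, hV, hVP⟩ := h_rich
  have hX_meas : ∀ X ∈ 𝒜, Measurable X := fun X hX => (h𝒜_meas X hX).mono h𝓕 le_rfl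
  have hlaw : ∀ X ∈ 𝒜, ∃ μ ∈ decisionLaws P 𝒜, (μ : Measure 𝒳) = P.map X := fun X hX =>
    ⟨⟨P.map X, Measure.isProbabilityMeasure_map (hX_meas X hX).aemeasurable⟩, ⟨X, hX, rfl⟩, rfl⟩
  have hM_ne : (decisionLaws P 𝒜).Nonempty := by
    obtain ⟨X, hX⟩ := h𝒜_nonempty
    obtain ⟨μ, hμ, -⟩ := hlaw X hX
    exact ⟨μ, hμ⟩
  -- Compactness passes to the coarser weak topology through the continuous identity map.
  have hΓ : ∀ μ ∈ decisionLaws P 𝒜, IsCompact (jointLaws 𝒴 μ) := fun μ hμ => by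
    obtain ⟨d, hd, hdΓ⟩ := h_compact
    have h := @IsCompact.image _ _ d.toPseudoMetricSpace.toUniformSpace.toTopologicalSpace
      ProbabilityMeasure.instTopologicalSpace _ id (hdΓ μ hμ) (continuous_id_iff_le.2 hd)
    rwa [image_id] at h
  refine ⟨fun θ hθ => ?_, fun η hη => ?_⟩
  · have hΦ : LowerSemicontinuous fun ν : ProbabilityMeasure 𝒴 =>
        ENNReal.ofReal θ * phiDiv φ (ν : Measure 𝒴) ν₀ :=
      (ENNReal.continuous_const_mul ENNReal.ofReal_ne_top).comp_lowerSemicontinuous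
        (lowerSemicontinuous_phiDiv hφ ν₀) fun _ _ h => mul_le_mul_right h _
    have h := exists_isMaxMinOptimizer_jointLaws hU_cont (abs_nonneg C) hC hM_ne h𝒜_compact hΓ
      isClosed_univ ⟨ν₀, mem_univ _⟩ hΦ
    simp only [preimage_univ, inter_univ] at h
    exact h
  · simp only [mem_iUnion] at hη
    obtain ⟨θ, -, hη⟩ := hη
    obtain ⟨μ₁, hμ₁⟩ := hM_ne
    have hne := divBall_nonempty_of_mem_concaveSubdifferential hφ ν₀ hU_cont hC hμ₁ (hΓ μ₁ hμ₁) hη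
    obtain ⟨μ, γ, hopt⟩ := exists_isMaxMinOptimizer_jointLaws hU_cont (abs_nonneg C) hC ⟨μ₁, hμ₁⟩
      h𝒜_compact hΓ (isClosed_divBall hφ ν₀ η) hne
      (Φ := fun _ => 0) lowerSemicontinuous_const
    simp only [← constrainedJointLaws_eq, EReal.coe_ennreal_zero, add_zero] at hopt
    refine ⟨μ, γ, hopt, ?_⟩
    obtain ⟨⟨X, hX, hμX⟩, hγ, hγ_min, hμ_max⟩ := hopt
    have hinf : ∀ X' ∈ 𝒜, ∀ μ' : ProbabilityMeasure 𝒳, (μ' : Measure 𝒳) = P.map X' →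
        ⨅ Y ∈ environments (𝓕 ⊔ 𝓕') P φ ν₀ η, ((∫ ω, U (X' ω) (Y ω) ∂P : ℝ) : EReal)
          = ⨅ γ' ∈ constrainedJointLaws φ ν₀ η μ', distObjective U γ' := fun X' hX' μ' hμ' =>
      iInf_environments_eq 𝓕 𝓕' h𝓕 h𝓕' P h_indep hV hVP (h𝒜_meas X' hX') hμ' φ ν₀ η
        hU_cont.measurable
    -- The inner value depends on `X` only through its law, so the suprema over `𝒜` and over its
    -- laws agree.
    have hval : maxMinValue 𝒜 (fun _ => environments (𝓕 ⊔ 𝓕') P φ ν₀ η)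
        (fun X' Y' => ((∫ ω, U (X' ω) (Y' ω) ∂P : ℝ) : EReal))
        = maxMinValue (decisionLaws P 𝒜) (constrainedJointLaws φ ν₀ η)
          (fun _ γ' => distObjective U γ') := by
      refine le_antisymm (iSup₂_le fun X' hX' => ?_) (iSup₂_le fun μ' hμ' => ?_)
      · obtain ⟨μ', hμ', hμX'⟩ := hlaw X' hX'
        rw [hinf X' hX' μ' hμX']
        exact le_iSup₂ (f := fun μ' _ => ⨅ γ' ∈ constrainedJointLaws φ ν₀ η μ',
          distObjective U γ') μ' hμ'
      · obtain ⟨X', hX', hμX'⟩ := hμ'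
        rw [← hinf X' hX' μ' hμX']
        exact le_iSup₂ (f := fun X' _ => ⨅ Y ∈ environments (𝓕 ⊔ 𝓕') P φ ν₀ η,
          ((∫ ω, U (X' ω) (Y ω) ∂P : ℝ) : EReal)) X' hX'
    obtain ⟨ν, hν, h₁, h₂⟩ := hγ
    obtain ⟨Y, hY, hYγ⟩ := exists_measurable_map_prodMk_eq 𝓕 𝓕' h𝓕 h𝓕' P h_indep hV hVP
      (h𝒜_meas X hX) (γ : Measure (𝒳 × 𝒴)) (h₁.trans hμX)
    have hY' : Measurable Y := hY.mono (sup_le h𝓕 h𝓕') le_rfl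
    have hobj : ((∫ ω, U (X ω) (Y ω) ∂P : ℝ) : EReal) = distObjective U γ := by
      rw [distObjective, ← hYγ]
      exact congrArg _ (integral_map ((hX_meas X hX).prodMk hY').aemeasurable
        hU_cont.measurable.aestronglyMeasurable).symm
    refine ⟨X, Y, ⟨hX, ⟨hY, ν, hν, ?_⟩, ?_, ?_⟩, hYγ⟩
    · rw [← h₂, ← hYγ, Measure.snd_map_prodMk (hX_meas X hX)]
    · exact hobj.trans (hγ_min.trans (hinf X hX μ hμX).symm)
    · exact (hinf X hX μ hμX).trans (hμ_max.trans hval.symm)
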